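/- Let $(\mathcal C,\otimes,I)$ be a closed braided monoidal category with braiding $\Phi$, with equalizers and coequalizers; $[X,-]$ denotes the right adjoint of $X\otimes-$. An object $X$ is *flat* if $X\otimes -$ preserves equalizers, and *faithfully flat* if $X\otimes -$ preserves and reflects equalizers. Let $H$ be a flat Hopf algebra in $\mathcal C$ with multiplication $\nabla_H$, unit $\eta_H$, comultiplication $\Delta_H$ and counit $\varepsilon_H$, and suppose that the braiding is $H$-linear, i.e. for all left $H$-modules $M,N$ in $\mathcal C$ the morphism $\Phi_{M,N}:M\otimes N\to N\otimes M$ is $H$-linear for the diagonal actions of $H$. Then the category ${}_H\mathcal C$ of left $H$-modules is a closed braided monoidal category with the braiding $\Phi$. An object $P$ of a closed braided monoidal category is *faithfully projective* if, with $P^*=[P,I]$, the canonical morphism $P^*\otimes P\to[P,P]$ is an isomorphism and evaluation induces an isomorphism $P\otimes_{[P,P]}P^*\cong I$. An algebra $A$ there, with opposite algebra $\overline A$ (multiplication $\nabla_A\Phi_{A,A}$), is *Azumaya* if it is faithfully projective and the canonical morphisms $A\otimes\overline A\to[A,A]$ and $\overline A\otimes A\to[A,A]$, induced by the left action $\nabla_A(A\otimes\nabla_A\Phi_{A,A}):A\otimes\overline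 A\otimes A\to A$ and by the right action $\nabla_A(\nabla_A\Phi_{A,A}\otimes A):A\otimes\overline A\otimes A\to A$, are isomorphisms. An *$H$-Azumaya algebra* is an Azumaya algebra in ${}_H\mathcal C$. Let $A$ be an $H$-Azumaya algebra with $H$-action $\nu:H\otimes A\to A$. The smash product $A\# H$ is the object $A\otimes H$ with unit $\eta_A\otimes\eta_H$ and multiplication $$(\nabla_A\otimes\nabla_H)(A\otimes\nu\otimes H\otimes H)(A\otimes H\otimes\Phi_{H,A}\otimes H)(A\otimes\Delta_H\otimes A\otimes H),$$ with the right $H$-coaction $A\otimes\Delta_H$. It is an $A$-bimodule by left and right multiplication along $A\otimes\eta_H:A\to A\# H$; write $l:A\otimes (A\# H)\to A\# H$ and $r:(A\# H)\otimes A\to A\# H$ for the two actions. Let $j:(A\# H)^A\to A\# H$ be the equalizer of the two morphisms $A\# H\to[A,A\# H]$ that correspond to $l$ and to $r\circ\Phi_{A,A\# H}$. Then $T=(A\# H)^A$ carries an algebra structure and a right $H$-comodule structure $\rho:T\to T\otimes H$ for which $j$ is a morphism of algebras and of right $H$-comodules, and with these structures $T$ is an $H$-Galois object: $T$ is a right $H$-comodule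 algebra (that is, $\rho$ is moreover an algebra morphism to the braided tensor product algebra $T\otimes H$), $T$ is faithfully flat, and the canonical morphism $\mathrm{can}_T=(\nabla_T\otimes H)(T\otimes\rho):T\otimes T\to T\otimes H$ is an isomorphism. -/

import Mathlib

open CategoryTheory MonoidalCategory Limits
open scoped MonObj ComonObj

universe v u

noncomputable section

namespace BraidedHopf

variable {C : Type u} [Category.{v} C] [MonoidalCategory.{v} C]

/-- The structure morphism `H ⊗ M ⟶ M` of a left `H`-module `M`. -/
def act (H : C) [MonObj H] (M : C) [ModObj H M] : H ⊗ M ⟶ M := γ[H, M]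

section Act

variable (H : C) [MonObj H]

lemma one_act (M : C) [ModObj H M] : η[H] ▷ M ≫ act H M = (λ_ M).hom :=
  ModObj.one_smul_self H M

lemma mul_act (M : C) [ModObj H M] :
    μ[H] ▷ M ≫ act H M = (α_ H H M).hom ≫ H ◁ act H M ≫ act H M :=
  ModObj.mul_smul_self H M

variable {H} in
lemma act_hom {M N : Mod C H} (f : M ⟶ N) : act H M.X ≫ f.hom = H ◁ f.hom ≫ act H N.X :=
  f.isModHom.smul_hom

variable {H} in
/-- A morphism of `C` that commutes with the actions, as a morphism of `H`-modules. -/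
def homMk {M N : Mod C H} (f : M.X ⟶ N.X) (h : act H M.X ≫ f = H ◁ f ≫ act H N.X) : M ⟶ N :=
  Mod.Hom.mk' f h

variable {H} in
@[simp]
lemma homMk_hom {M N : Mod C H} (f : M.X ⟶ N.X) (h : act H M.X ≫ f = H ◁ f ≫ act H N.X) :
    (homMk f h).hom = f := rfl

variable {H} in
/-- An isomorphism of `C` that commutes with the actions, as an isomorphism of `H`-modules. -/
def isoMk {M N : Mod C H} (f : M.X ≅ N.X) (h : act H M.X ≫ f.hom = H ◁ f.hom ≫ act H N.X) :
    M ≅ N where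
  hom := homMk f.hom h
  inv := homMk f.inv (by
    rw [Iso.comp_inv_eq, Category.assoc, h, ← Category.assoc, ← MonoidalCategory.whiskerLeft_comp]
    simp)
  hom_inv_id := Mod.hom_ext _ _ (by simp)
  inv_hom_id := Mod.hom_ext _ _ (by simp)

variable {H} in
@[simp]
lemma isoMk_hom_hom {M N : Mod C H} (f : M.X ≅ N.X)
    (h : act H M.X ≫ f.hom = H ◁ f.hom ≫ act H N.X) : (isoMk f h).hom.hom = f.hom := rfl

variable {H} in
@[simp]
lemma isoMk_inv_hom {M N : Mod C H} (f : M.X ≅ N.X)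
    (h : act H M.X ≫ f.hom = H ◁ f.hom ≫ act H N.X) : (isoMk f h).inv.hom = f.inv := rfl

end Act

section Modules

variable [BraidedCategory C] (H : C) [BimonObj H]

/-- The diagonal action `h (m ⊗ n) = h₁ m ⊗ h₂ n` on a tensor product of two `H`-modules. -/
def diagAct (M N : C) [ModObj H M] [ModObj H N] : H ⊗ (M ⊗ N) ⟶ M ⊗ N :=
  Δ[H] ▷ (M ⊗ N) ≫ tensorμ H H M N ≫ (act H M ⊗ₘ act H N)

lemma one_diagAct (M N : C) [ModObj H M] [ModObj H N] :
    η[H] ▷ (M ⊗ N) ≫ diagAct H M N = (λ_ (M ⊗ N)).hom := by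
  have h : η[H] ≫ Δ[H] = (λ_ (𝟙_ C)).inv ≫ (η[H] ⊗ₘ η[H]) := by
    rw [BimonObj.one_comul]; rfl
  rw [diagAct, ← comp_whiskerRight_assoc, h, comp_whiskerRight, Category.assoc,
    tensorμ_natural_left_assoc, tensorHom_comp_tensorHom, one_act, one_act,
    ← tensor_left_unitality]

lemma mul_diagAct (M N : C) [ModObj H M] [ModObj H N] :
    μ[H] ▷ (M ⊗ N) ≫ diagAct H M N =
      (α_ H H (M ⊗ N)).hom ≫ H ◁ diagAct H M N ≫ diagAct H M N := by
  have e1 : μ[H] ▷ (M ⊗ N) ≫ diagAct H M N =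
      (Δ[H] ⊗ₘ Δ[H]) ▷ (M ⊗ N) ≫ tensorμ H H H H ▷ (M ⊗ N) ≫ tensorμ (H ⊗ H) (H ⊗ H) M N ≫
        ((α_ H H M).hom ⊗ₘ (α_ H H N).hom) ≫ (H ◁ act H M ⊗ₘ H ◁ act H N) ≫
          (act H M ⊗ₘ act H N) := by
    rw [diagAct, ← comp_whiskerRight_assoc, BimonObj.mul_comul]
    simp only [comp_whiskerRight, Category.assoc]
    rw [tensorμ_natural_left_assoc]
    simp only [tensorHom_comp_tensorHom, mul_act]
  rw [e1, tensor_associativity_assoc]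
  have e2 : H ◁ diagAct H M N ≫ diagAct H M N =
      H ◁ (Δ[H] ▷ (M ⊗ N)) ≫ Δ[H] ▷ ((H ⊗ H) ⊗ (M ⊗ N)) ≫ (H ⊗ H) ◁ tensorμ H H M N ≫
        tensorμ H H (H ⊗ M) (H ⊗ N) ≫ (H ◁ act H M ⊗ₘ H ◁ act H N) ≫
          (act H M ⊗ₘ act H N) := by
    rw [← tensorμ_natural_right_assoc]
    simp only [diagAct, MonoidalCategory.whiskerLeft_comp, Category.assoc]
    rw [whisker_exchange_assoc, whisker_exchange_assoc]
  rw [e2, MonoidalCategory.tensorHom_def]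
  simp only [comp_whiskerRight, Category.assoc]
  rw [associator_naturality_middle_assoc, associator_naturality_left_assoc,
    whisker_exchange_assoc]

/-- The tensor product of two `H`-modules is an `H`-module by the diagonal action. -/
instance tensorModObj (M N : C) [ModObj H M] [ModObj H N] : ModObj H (M ⊗ N) where
  smul := diagAct H M N
  one_smul := one_diagAct H M N
  mul_smul := mul_diagAct H M N

lemma act_tensor (M N : C) [ModObj H M] [ModObj H N] : act H (M ⊗ N) = diagAct H M N := rfl

/-- The trivial action on the unit object, given by the counit of `H`. -/
def unitAct : H ⊗ 𝟙_ C ⟶ 𝟙_ C := ε[H] ▷ 𝟙_ C ≫ (λ_ (𝟙_ C)).hom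

/-- The unit object with the trivial `H`-action. -/
instance unitModObj : ModObj H (𝟙_ C) where
  smul := unitAct H
  one_smul := by
    change η[H] ▷ 𝟙_ C ≫ unitAct H = (λ_ (𝟙_ C)).hom
    rw [unitAct, ← comp_whiskerRight_assoc, BimonObj.one_counit]; simp
  mul_smul := by
    change μ[H] ▷ 𝟙_ C ≫ unitAct H = (α_ H H (𝟙_ C)).hom ≫ H ◁ unitAct H ≫ unitAct H
    have h : μ[H] ≫ ε[H] = (ε[H] ⊗ₘ ε[H]) ≫ (λ_ (𝟙_ C)).hom := by
      rw [BimonObj.mul_counit]; rfl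
    rw [unitAct, ← comp_whiskerRight_assoc, h, MonoidalCategory.tensorHom_def']
    simp only [MonoidalCategory.whiskerLeft_comp, comp_whiskerRight, Category.assoc]
    monoidal

variable {H}

/-- The tensor product of `H`-modules. -/
abbrev tensorMod (M N : Mod C H) : Mod C H := ⟨M.X ⊗ N.X⟩

variable (H) in
/-- The unit `H`-module. -/
abbrev unitMod : Mod C H := ⟨𝟙_ C⟩

lemma act_unit : act H (𝟙_ C) = unitAct H := rfl

lemma diagAct_natural {M M' N N' : Mod C H} (f : M ⟶ M') (g : N ⟶ N') :
    diagAct H M.X N.X ≫ (f.hom ⊗ₘ g.hom) = H ◁ (f.hom ⊗ₘ g.hom) ≫ diagAct H M'.X N'.X := by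
  simp only [diagAct, Category.assoc, tensorHom_comp_tensorHom, act_hom]
  rw [← tensorHom_comp_tensorHom, ← tensorμ_natural_right_assoc, whisker_exchange_assoc]

lemma diagAct_assoc (M N P : Mod C H) :
    diagAct H (M.X ⊗ N.X) P.X ≫ (α_ M.X N.X P.X).hom =
      H ◁ (α_ M.X N.X P.X).hom ≫ diagAct H M.X (N.X ⊗ P.X) := by
  have e1 : diagAct H (M.X ⊗ N.X) P.X ≫ (α_ M.X N.X P.X).hom =
      (Δ[H] ≫ Δ[H] ▷ H) ▷ ((M.X ⊗ N.X) ⊗ P.X) ≫ tensorμ (H ⊗ H) H (M.X ⊗ N.X) P.X ≫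
        tensorμ H H M.X N.X ▷ (H ⊗ P.X) ≫ (α_ (H ⊗ M.X) (H ⊗ N.X) (H ⊗ P.X)).hom ≫
          (act H M.X ⊗ₘ act H N.X ⊗ₘ act H P.X) := by
    have := tensorμ_natural_left Δ[H] (𝟙 H) (M.X ⊗ N.X) P.X
    rw [tensorHom_id] at this
    rw [comp_whiskerRight_assoc, reassoc_of% this, diagAct, act_tensor, diagAct,
      ← associator_naturality]
    simp only [Category.assoc, ← tensorHom_id, tensorHom_comp_tensorHom_assoc]
    simp
  have e2 : H ◁ (α_ M.X N.X P.X).hom ≫ diagAct H M.X (N.X ⊗ P.X) =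
      H ◁ (α_ M.X N.X P.X).hom ≫ (Δ[H] ≫ H ◁ Δ[H]) ▷ (M.X ⊗ N.X ⊗ P.X) ≫
        tensorμ H (H ⊗ H) M.X (N.X ⊗ P.X) ≫ (H ⊗ M.X) ◁ tensorμ H H N.X P.X ≫
          (act H M.X ⊗ₘ act H N.X ⊗ₘ act H P.X) := by
    have := tensorμ_natural_left (𝟙 H) Δ[H] M.X (N.X ⊗ P.X)
    rw [id_tensorHom] at this
    rw [comp_whiskerRight_assoc, reassoc_of% this, diagAct, act_tensor, diagAct]
    simp only [← id_tensorHom, tensorHom_comp_tensorHom]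
    simp
  rw [e1, e2, associator_monoidal_assoc, ComonObj.comul_assoc, MonoidalCategory.tensorHom_def']
  simp only [comp_whiskerRight, Category.assoc]
  simp only [whisker_exchange_assoc]

lemma diagAct_leftUnitor (M : Mod C H) :
    diagAct H (𝟙_ C) M.X ≫ (λ_ M.X).hom = H ◁ (λ_ M.X).hom ≫ act H M.X := by
  have h := tensorμ_natural_left ε[H] (𝟙 H) (𝟙_ C) M.X
  rw [tensorHom_id] at h
  have e : diagAct H (𝟙_ C) M.X ≫ (λ_ M.X).hom =
      (Δ[H] ≫ ε[H] ▷ H) ▷ (𝟙_ C ⊗ M.X) ≫ tensorμ (𝟙_ C) H (𝟙_ C) M.X ≫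
        (λ_ (𝟙_ C)).hom ▷ (H ⊗ M.X) ≫ (λ_ (H ⊗ M.X)).hom ≫ act H M.X := by
    rw [comp_whiskerRight_assoc, reassoc_of% h, diagAct, act_unit, unitAct,
      ← leftUnitor_naturality]
    simp only [← tensorHom_id, ← id_tensorHom, tensorHom_comp_tensorHom_assoc]
    simp
  rw [e, ← leftUnitor_monoidal_assoc, ComonObj.counit_comul, MonoidalCategory.tensorHom_def]
  simp

lemma diagAct_rightUnitor (M : Mod C H) :
    diagAct H M.X (𝟙_ C) ≫ (ρ_ M.X).hom = H ◁ (ρ_ M.X).hom ≫ act H M.X := by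
  have h := tensorμ_natural_left (𝟙 H) ε[H] M.X (𝟙_ C)
  rw [id_tensorHom] at h
  have e : diagAct H M.X (𝟙_ C) ≫ (ρ_ M.X).hom =
      (Δ[H] ≫ H ◁ ε[H]) ▷ (M.X ⊗ 𝟙_ C) ≫ tensorμ H (𝟙_ C) M.X (𝟙_ C) ≫
        (H ⊗ M.X) ◁ (λ_ (𝟙_ C)).hom ≫ (ρ_ (H ⊗ M.X)).hom ≫ act H M.X := by
    rw [comp_whiskerRight_assoc, reassoc_of% h, diagAct, act_unit, unitAct,
      ← rightUnitor_naturality]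
    simp only [← tensorHom_id, ← id_tensorHom, tensorHom_comp_tensorHom_assoc]
    simp
  rw [e, ← rightUnitor_monoidal_assoc, ComonObj.comul_counit, MonoidalCategory.tensorHom_def]
  simp

/-- The category of left modules over a bialgebra is monoidal. -/
instance : MonoidalCategory (Mod C H) where
  tensorObj := tensorMod
  tensorUnit := unitMod H
  tensorHom f g := homMk (f.hom ⊗ₘ g.hom) (diagAct_natural f g)
  whiskerLeft M _ _ f := homMk (M.X ◁ f.hom) (by simpa using! diagAct_natural (𝟙 M) f)
  whiskerRight f N := homMk (f.hom ▷ N.X) (by simpa using! diagAct_natural f (𝟙 N))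
  associator M N P := isoMk (α_ M.X N.X P.X) (diagAct_assoc M N P)
  leftUnitor M := isoMk (λ_ M.X) (diagAct_leftUnitor M)
  rightUnitor M := isoMk (ρ_ M.X) (diagAct_rightUnitor M)
  tensorHom_def f g := Mod.hom_ext _ _ (MonoidalCategory.tensorHom_def f.hom g.hom)
  id_tensorHom_id M N := Mod.hom_ext _ _ (id_tensorHom_id M.X N.X)
  tensorHom_comp_tensorHom f g h k :=
    Mod.hom_ext _ _ (tensorHom_comp_tensorHom f.hom g.hom h.hom k.hom)
  whiskerLeft_id M N := Mod.hom_ext _ _ (whiskerLeft_id M.X N.X)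
  id_whiskerRight M N := Mod.hom_ext _ _ (id_whiskerRight M.X N.X)
  associator_naturality f g h := Mod.hom_ext _ _ (associator_naturality f.hom g.hom h.hom)
  leftUnitor_naturality f := Mod.hom_ext _ _ (leftUnitor_naturality f.hom)
  rightUnitor_naturality f := Mod.hom_ext _ _ (rightUnitor_naturality f.hom)
  pentagon M N P Q := Mod.hom_ext _ _ (pentagon M.X N.X P.X Q.X)
  triangle M N := Mod.hom_ext _ _ (triangle M.X N.X)

/-- The braiding of `C` is `H`-linear: for all left `H`-modules `M` and `N`, the braiding
`M ⊗ N ⟶ N ⊗ M` is a morphism of `H`-modules for the diagonal actions. -/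
class BraidingLinear (H : C) [BimonObj H] : Prop where
  linear (M N : Mod C H) :
    act H (M.X ⊗ N.X) ≫ (β_ M.X N.X).hom = H ◁ (β_ M.X N.X).hom ≫ act H (N.X ⊗ M.X)

/-- If the braiding of `C` is `H`-linear, then it is a braiding on the category of `H`-modules. -/
instance [BraidingLinear H] : BraidedCategory (Mod C H) where
  braiding M N := isoMk (β_ M.X N.X) (BraidingLinear.linear M N)
  braiding_naturality_right M _ _ f :=
    Mod.hom_ext _ _ (BraidedCategory.braiding_naturality_right M.X f.hom)
  braiding_naturality_left f M :=
    Mod.hom_ext _ _ (BraidedCategory.braiding_naturality_left f.hom M.X)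
  hexagon_forward M N P := Mod.hom_ext _ _ (BraidedCategory.hexagon_forward M.X N.X P.X)
  hexagon_reverse M N P := Mod.hom_ext _ _ (BraidedCategory.hexagon_reverse M.X N.X P.X)

end Modules

section Closed

variable [BraidedCategory C] {H : C} [BimonObj H]

attribute [local instance] ModObj.regular

lemma act_regular : act H H = μ[H] := rfl

/-- Auxiliary: the value of the diagonal action of `H` on `H ⊗ H` at the units. -/
lemma diagAct_units :
    (ρ_ H).inv ≫ H ◁ ((λ_ (𝟙_ C)).inv ≫ (η[H] ⊗ₘ η[H])) ≫ diagAct H H H = Δ[H] := by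
  rw [diagAct, whisker_exchange_assoc, MonoidalCategory.whiskerLeft_comp_assoc,
    tensorμ_natural_right_assoc, act_regular, tensorHom_comp_tensorHom, MonObj.mul_one,
    ← tensor_right_unitality, rightUnitor_naturality, Iso.inv_hom_id_assoc]

variable (H) in
/-- If the braiding is `H`-linear, then `H` is cocommutative. -/
lemma comul_braiding [BraidingLinear H] : Δ[H] ≫ (β_ H H).hom = Δ[H] := by
  have h : diagAct H H H ≫ (β_ H H).hom = H ◁ (β_ H H).hom ≫ diagAct H H H :=
    BraidingLinear.linear (Mod.regular H) (Mod.regular H)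
  have h' : ((λ_ (𝟙_ C)).inv ≫ (η[H] ⊗ₘ η[H])) ≫ (β_ H H).hom =
      (λ_ (𝟙_ C)).inv ≫ (η[H] ⊗ₘ η[H]) := by
    rw [Category.assoc, BraidedCategory.braiding_naturality]
    simp [unitors_inv_equal]
  conv_lhs => rw [← diagAct_units]
  simp only [Category.assoc]
  rw [h, ← MonoidalCategory.whiskerLeft_comp_assoc, h', diagAct_units]

variable (H) in
/-- The entwining `h ⊗ m ↦ h₁ m ⊗ h₂`. -/
def entwine (M : C) [ModObj H M] : H ⊗ M ⟶ M ⊗ H :=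
  Δ[H] ▷ M ≫ (α_ H H M).hom ≫ H ◁ (β_ H M).hom ≫ (α_ H M H).inv ≫ act H M ▷ H

lemma diagAct_eq (M X : C) [ModObj H M] [ModObj H X] :
    diagAct H M X =
      (α_ H M X).inv ≫ entwine H M ▷ X ≫ (α_ M H X).hom ≫ M ◁ act H X := by
  simp only [diagAct, entwine, tensorμ, comp_whiskerRight, Category.assoc,
    MonoidalCategory.tensorHom_def]
  monoidal

lemma entwine_eq (M : C) [ModObj H M] :
    entwine H M = H ◁ ((ρ_ M).inv ≫ M ◁ η[H]) ≫ diagAct H M H := by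
  rw [diagAct_eq, act_regular]
  have : H ◁ ((ρ_ M).inv ≫ M ◁ η[H]) ≫ (α_ H M H).inv ≫ entwine H M ▷ H =
      entwine H M ≫ (ρ_ _).inv ≫ (M ⊗ H) ◁ η[H] := by
    simp only [MonoidalCategory.whiskerLeft_comp, Category.assoc]
    rw [associator_inv_naturality_right_assoc, whisker_exchange]
    monoidal
  rw [reassoc_of% this, associator_naturality_right_assoc, ← MonoidalCategory.whiskerLeft_comp,
    MonObj.mul_one]
  monoidal

lemma one_entwine (M : C) [ModObj H M] :
    η[H] ▷ M ≫ entwine H M = (λ_ M).hom ≫ (ρ_ M).inv ≫ M ◁ η[H] := by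
  rw [entwine_eq, ← whisker_exchange_assoc, one_diagAct, leftUnitor_naturality]

lemma mul_entwine (M : C) [ModObj H M] :
    μ[H] ▷ M ≫ entwine H M = (α_ H H M).hom ≫ H ◁ entwine H M ≫ (α_ H M H).inv ≫
      entwine H M ▷ H ≫ (α_ M H H).hom ≫ M ◁ μ[H] := by
  conv_lhs => rw [entwine_eq, ← whisker_exchange_assoc, mul_diagAct]
  have := diagAct_eq (H := H) M H
  rw [act_regular] at this
  rw [← this, associator_naturality_right_assoc, ← MonoidalCategory.whiskerLeft_comp_assoc,
    ← entwine_eq]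

end Closed

section Closed

variable [BraidedCategory C] {H : C} [HopfObj H]

/-- Auxiliary: `h ⊗ m ↦ h₁ ⊗ h₂ m`. -/
def fusion (M : C) [ModObj H M] : H ⊗ M ⟶ H ⊗ M :=
  Δ[H] ▷ M ≫ (α_ H H M).hom ≫ H ◁ act H M

/-- Auxiliary: `h ⊗ m ↦ h₁ ⊗ S(h₂) m`. -/
def fusionInv (M : C) [ModObj H M] : H ⊗ M ⟶ H ⊗ M :=
  Δ[H] ▷ M ≫ (α_ H H M).hom ≫ H ◁ (HopfObj.antipode ▷ M ≫ act H M)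

lemma fusion_aux (f g k : H ⟶ H) (h : Δ[H] ≫ f ▷ H ≫ H ◁ g ≫ μ[H] = k) (M : C) [ModObj H M] :
    Δ[H] ▷ M ≫ (α_ H H M).hom ≫ H ◁ (g ▷ M ≫ act H M) ≫ Δ[H] ▷ M ≫ (α_ H H M).hom ≫
      H ◁ (f ▷ M ≫ act H M) = Δ[H] ▷ M ≫ (α_ H H M).hom ≫ H ◁ (k ▷ M ≫ act H M) := by
  have h1 : H ◁ (g ▷ M ≫ act H M) ≫ Δ[H] ▷ M ≫ (α_ H H M).hom ≫ H ◁ (f ▷ M ≫ act H M) =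
      Δ[H] ▷ (H ⊗ M) ≫ (α_ H H (H ⊗ M)).hom ≫
        H ◁ (f ▷ (H ⊗ M) ≫ H ◁ (g ▷ M) ≫ (α_ H H M).inv ≫ μ[H] ▷ M ≫ act H M) := by
    rw [mul_act, Iso.inv_hom_id_assoc, whisker_exchange_assoc, associator_naturality_right_assoc]
    simp only [← MonoidalCategory.whiskerLeft_comp]
    rw [whisker_exchange_assoc]
    simp only [MonoidalCategory.whiskerLeft_comp, Category.assoc]
  have h2 : f ▷ (H ⊗ M) ≫ H ◁ (g ▷ M) ≫ (α_ H H M).inv ≫ μ[H] ▷ M ≫ act H M =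
      (α_ H H M).inv ≫ (f ▷ H ≫ H ◁ g ≫ μ[H]) ▷ M ≫ act H M := by
    monoidal
  have h3 : Δ[H] ▷ M ≫ (α_ H H M).hom ≫ Δ[H] ▷ (H ⊗ M) ≫ (α_ H H (H ⊗ M)).hom ≫
      H ◁ (α_ H H M).inv = Δ[H] ▷ M ≫ (α_ H H M).hom ≫ H ◁ (Δ[H] ▷ M) := by
    have : Δ[H] ▷ M ≫ (α_ H H M).hom ≫ H ◁ (Δ[H] ▷ M) =
        (Δ[H] ≫ H ◁ Δ[H]) ▷ M ≫ (α_ H (H ⊗ H) M).hom := by monoidal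
    rw [this, ComonObj.comul_assoc]
    monoidal
  rw [h1, h2, MonoidalCategory.whiskerLeft_comp, reassoc_of% h3,
    ← MonoidalCategory.whiskerLeft_comp, ← comp_whiskerRight_assoc, h]

lemma fusion_unit (M : C) [ModObj H M] :
    Δ[H] ▷ M ≫ (α_ H H M).hom ≫ H ◁ ((ε[H] ≫ η[H]) ▷ M ≫ act H M) = 𝟙 _ := by
  rw [comp_whiskerRight, Category.assoc, one_act]
  have : Δ[H] ▷ M ≫ (α_ H H M).hom ≫ H ◁ (ε[H] ▷ M ≫ (λ_ M).hom) =
      (Δ[H] ≫ H ◁ ε[H]) ▷ M ≫ (α_ H (𝟙_ C) M).hom ≫ H ◁ (λ_ M).hom := by monoidal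
  rw [this, ComonObj.comul_counit]
  monoidal

lemma fusion_fusionInv (M : C) [ModObj H M] : fusion M ≫ fusionInv M = 𝟙 (H ⊗ M) := by
  have := fusion_aux (H := H) HopfObj.antipode (𝟙 H) (ε[H] ≫ η[H])
    (by simp) M
  rw [fusion_unit] at this
  simpa [fusion, fusionInv] using this

lemma fusionInv_fusion (M : C) [ModObj H M] : fusionInv M ≫ fusion M = 𝟙 (H ⊗ M) := by
  have := fusion_aux (H := H) (𝟙 H) HopfObj.antipode (ε[H] ≫ η[H])
    (by simp) M
  rw [fusion_unit] at this
  simpa [fusion, fusionInv] using this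

lemma entwine_fusion [BraidingLinear H] (M : C) [ModObj H M] :
    entwine H M = fusion M ≫ (β_ H M).hom := by
  rw [fusion, Category.assoc, Category.assoc, BraidedCategory.braiding_naturality_right,
    BraidedCategory.braiding_tensor_right_hom]
  simp only [Category.assoc, Iso.hom_inv_id_assoc]
  rw [← comp_whiskerRight_assoc, comul_braiding, entwine]

/-- The entwining `h ⊗ m ↦ h₁ m ⊗ h₂` is invertible, with inverse `m ⊗ h ↦ h₁ ⊗ S(h₂) m` (up to
the braiding). -/
def entwineIso [BraidingLinear H] (M : C) [ModObj H M] : H ⊗ M ≅ M ⊗ H where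
  hom := entwine H M
  inv := (β_ H M).inv ≫ fusionInv M
  hom_inv_id := by simp [entwine_fusion, fusion_fusionInv]
  inv_hom_id := by simp [entwine_fusion, reassoc_of% fusionInv_fusion (H := H)]

/-- The morphism `m ⊗ h ⊗ x ↦ h₁ k(S(h₂) m ⊗ x)` associated with a morphism `k : M ⊗ X ⟶ N`. -/
def conjAct [BraidingLinear H] {M X N : C} [ModObj H M] [ModObj H N] (k : M ⊗ X ⟶ N) :
    M ⊗ (H ⊗ X) ⟶ N :=
  (α_ M H X).inv ≫ (entwineIso M).inv ▷ X ≫ (α_ H M X).hom ≫ H ◁ k ≫ act H N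

lemma eq_conjAct_iff [BraidingLinear H] {M X N : C} [ModObj H M] [ModObj H N] (k : M ⊗ X ⟶ N)
    (l : M ⊗ (H ⊗ X) ⟶ N) : l = conjAct k ↔
      (α_ H M X).inv ≫ entwine H M ▷ X ≫ (α_ M H X).hom ≫ l = H ◁ k ≫ act H N := by
  have : entwine H M = (entwineIso M).hom := rfl
  rw [conjAct, this]
  constructor
  · rintro rfl
    simp
  · intro h
    rw [← h]
    simp

lemma conjAct_natural [BraidingLinear H] {M X X' N : C} [ModObj H M] [ModObj H N]
    (f : X ⟶ X') (k : M ⊗ X' ⟶ N) :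
    M ◁ (H ◁ f) ≫ conjAct k = conjAct (M ◁ f ≫ k) := by
  simp only [conjAct, MonoidalCategory.whiskerLeft_comp, Category.assoc]
  rw [associator_inv_naturality_right_assoc, whisker_exchange_assoc,
    associator_naturality_right_assoc]

lemma one_conjAct [BraidingLinear H] {M X N : C} [ModObj H M] [ModObj H N] (k : M ⊗ X ⟶ N) :
    M ◁ (η[H] ▷ X) ≫ conjAct k = M ◁ (λ_ X).hom ≫ k := by
  have h : M ◁ η[H] ≫ (entwineIso (H := H) M).inv = (ρ_ M).hom ≫ (λ_ M).inv ≫ η[H] ▷ M := by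
    rw [Iso.comp_inv_eq]
    change _ = _ ≫ entwine H M
    simp [one_entwine]
  have h' : M ◁ (η[H] ▷ X) ≫ conjAct k = (α_ M (𝟙_ C) X).inv ≫
      (M ◁ η[H] ≫ (entwineIso (H := H) M).inv) ▷ X ≫ (α_ H M X).hom ≫ H ◁ k ≫ act H N := by
    rw [conjAct]; monoidal
  rw [h', h]
  simp only [comp_whiskerRight, Category.assoc, associator_naturality_left_assoc]
  rw [← whisker_exchange_assoc, one_act]
  monoidal

lemma mul_conjAct [BraidingLinear H] {M X N : C} [ModObj H M] [ModObj H N] (k : M ⊗ X ⟶ N) :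
    M ◁ (μ[H] ▷ X) ≫ conjAct k = M ◁ (α_ H H X).hom ≫ conjAct (conjAct k) := by
  have h := mul_entwine (H := H) M
  rw [← cancel_epi (M ◁ (α_ H H X).inv), ← MonoidalCategory.whiskerLeft_comp_assoc,
    ← MonoidalCategory.whiskerLeft_comp_assoc, Iso.inv_hom_id, MonoidalCategory.whiskerLeft_id,
    Category.id_comp, eq_conjAct_iff]
  have h2 : H ◁ conjAct k ≫ act H N =
      (α_ H M (H ⊗ X)).inv ≫ (α_ (H ⊗ M) H X).inv ≫ (α_ H M H).hom ▷ X ≫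
      (H ◁ (entwineIso (H := H) M).inv) ▷ X ≫ (α_ H H M).inv ▷ X ≫
      (μ[H] ▷ M) ▷ X ≫ (α_ H M X).hom ≫ H ◁ k ≫ act H N := by
    rw [associator_naturality_left_assoc, ← whisker_exchange_assoc, mul_act, conjAct]
    monoidal
  rw [h2, ← cancel_epi ((α_ H M (H ⊗ X)).hom), ← cancel_epi ((α_ (H ⊗ M) H X).hom),
    ← cancel_epi ((α_ H M H).inv ▷ X), ← cancel_epi ((H ◁ (entwineIso (H := H) M).hom) ▷ X),
    ← cancel_epi ((α_ H H M).hom ▷ X)]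
  have h3 : (α_ H H M).hom ▷ X ≫ (H ◁ (entwineIso (H := H) M).hom) ▷ X ≫
      (α_ H M H).inv ▷ X ≫ (α_ (H ⊗ M) H X).hom ≫ (α_ H M (H ⊗ X)).hom ≫
      (α_ H M (H ⊗ X)).inv ≫ entwine H M ▷ (H ⊗ X) ≫ (α_ M H (H ⊗ X)).hom ≫
      M ◁ ((α_ H H X).inv ≫ μ[H] ▷ X) ≫ conjAct k =
      ((α_ H H M).hom ≫ H ◁ entwine H M ≫ (α_ H M H).inv ≫
      entwine H M ▷ H ≫ (α_ M H H).hom ≫ M ◁ μ[H]) ▷ X ≫ (entwineIso (H := H) M).inv ▷ X ≫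
        (α_ H M X).hom ≫ H ◁ k ≫ act H N := by
    rw [conjAct]
    change (α_ H H M).hom ▷ X ≫ (H ◁ entwine H M) ▷ X ≫ _ = _
    monoidal
  rw [h3, ← h]
  have h4 : (μ[H] ▷ M ≫ entwine H M) ▷ X ≫ (entwineIso (H := H) M).inv ▷ X =
      (μ[H] ▷ M) ▷ X := by
    rw [← comp_whiskerRight, Category.assoc]
    change (_ ≫ (entwineIso (H := H) M).hom ≫ _) ▷ X = _
    simp
  rw [reassoc_of% h4]
  simp

variable [MonoidalClosed C] [BraidingLinear H]

/-- The inner hom `[M, N]` of two `H`-modules is an `H`-module by `(h f)(m) = h₁ f(S(h₂) m)`. -/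
instance ihomModObj (M N : C) [ModObj H M] [ModObj H N] : ModObj H ((ihom M).obj N) where
  smul := MonoidalClosed.curry (conjAct ((ihom.ev M).app N))
  one_smul := by
    change η[H] ▷ _ ≫ MonoidalClosed.curry _ = (λ_ _).hom
    rw [← MonoidalClosed.curry_natural_left, one_conjAct, MonoidalClosed.curry_eq_iff]
    rfl
  mul_smul := by
    change μ[H] ▷ _ ≫ MonoidalClosed.curry _ = (α_ _ _ _).hom ≫
      H ◁ MonoidalClosed.curry _ ≫ MonoidalClosed.curry _
    rw [← MonoidalClosed.curry_natural_left, ← MonoidalClosed.curry_natural_left,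
      ← MonoidalClosed.curry_natural_left, mul_conjAct, conjAct_natural,
      MonoidalClosed.whiskerLeft_curry_ihom_ev_app]

/-- The inner hom of two `H`-modules. -/
abbrev ihomMod (M N : Mod C H) : Mod C H := ⟨(ihom M.X).obj N.X⟩

lemma act_ihomMod (M N : Mod C H) : act H (ihomMod M N).X =
    MonoidalClosed.curry (conjAct (N := N.X) ((ihom.ev M.X).app N.X)) := rfl

lemma linear_iff_curry (M X N : Mod C H) (f : M.X ⊗ X.X ⟶ N.X) :
    diagAct H M.X X.X ≫ f = H ◁ f ≫ act H N.X ↔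
      act H X.X ≫ MonoidalClosed.curry f = H ◁ MonoidalClosed.curry f ≫ act H (ihomMod M N).X := by
  rw [act_ihomMod, ← MonoidalClosed.curry_natural_left]
  have e : H ◁ MonoidalClosed.curry f ≫ MonoidalClosed.curry (conjAct (N := N.X) ((ihom.ev M.X).app N.X)) =
      MonoidalClosed.curry (conjAct f) := by
    rw [← MonoidalClosed.curry_natural_left, conjAct_natural,
      MonoidalClosed.whiskerLeft_curry_ihom_ev_app]
  refine Iff.trans (b := M.X ◁ act H X.X ≫ f = conjAct f) ?_ ?_
  · rw [eq_conjAct_iff, diagAct_eq]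
    simp only [Category.assoc]
  · exact MonoidalClosed.curry_injective.eq_iff.symm.trans
      ⟨fun h => h.trans e.symm, fun h => h.trans e⟩

lemma linear_uncurry (M X N : Mod C H) (g : X.X ⟶ (ihom M.X).obj N.X)
    (h : act H X.X ≫ g = H ◁ g ≫ act H (ihomMod M N).X) :
    diagAct H M.X X.X ≫ MonoidalClosed.uncurry g =
      H ◁ MonoidalClosed.uncurry g ≫ act H N.X := by
  rw [linear_iff_curry, MonoidalClosed.curry_uncurry]
  exact h

/-- The correspondence between `H`-linear morphisms `M ⊗ X ⟶ N` and `X ⟶ [M, N]`. -/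
def ihomModEquiv (M X N : Mod C H) : (M ⊗ X ⟶ N) ≃ (X ⟶ ihomMod M N) where
  toFun f := homMk (MonoidalClosed.curry f.hom) ((linear_iff_curry M X N f.hom).1 (act_hom f))
  invFun g := homMk (MonoidalClosed.uncurry g.hom) (linear_uncurry M X N g.hom (act_hom g))
  left_inv f := Mod.hom_ext _ _ (MonoidalClosed.uncurry_curry f.hom)
  right_inv g := Mod.hom_ext _ _ (MonoidalClosed.curry_uncurry g.hom)

/-- The category of left modules over a Hopf algebra is closed, if the braiding is linear. -/
instance : MonoidalClosed (Mod C H) where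
  closed M :=
    { rightAdj := Adjunction.rightAdjointOfEquiv (F := tensorLeft M) (ihomModEquiv M)
        (fun _ _ _ f g => Mod.hom_ext _ _ (MonoidalClosed.curry_natural_left f.hom g.hom))
      adj := Adjunction.adjunctionOfEquivRight _ _ }

end Closed

section Flat

/-- An object `X` is flat if `X ⊗ -` preserves equalizers. -/
def Flat (X : C) : Prop :=
  PreservesLimitsOfShape WalkingParallelPair (tensorLeft X)

/-- An object `X` is faithfully flat if `X ⊗ -` preserves and reflects equalizers. -/
def FaithfullyFlat (X : C) : Prop :=
  Flat X ∧ ReflectsLimitsOfShape WalkingParallelPair (tensorLeft X)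

end Flat

section Azumaya

variable [MonoidalClosed C]

/-- The dual `P* = [P, I]` of an object. -/
abbrev dual (P : C) : C := (ihom P).obj (𝟙_ C)

/-- The evaluation `P ⊗ P* ⟶ I`. -/
def evDual (P : C) : P ⊗ dual P ⟶ 𝟙_ C := (ihom.ev P).app (𝟙_ C)

/-- The evaluation `P ⊗ [P, P] ⟶ P`, which makes `P` a module over the algebra `[P, P]`. -/
def evEnd (P : C) : P ⊗ (ihom P).obj P ⟶ P := (ihom.ev P).app P

/-- The canonical morphism `P* ⊗ P ⟶ [P, P]`, `(f ⊗ p) ↦ (x ↦ f(x) p)`. -/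
def dualToEnd (P : C) : dual P ⊗ P ⟶ (ihom P).obj P :=
  MonoidalClosed.curry ((α_ P (dual P) P).inv ≫ evDual P ▷ P ≫ (λ_ P).hom)

/-- An object `P` is finite if the canonical morphism `P* ⊗ P ⟶ [P, P]` is an isomorphism. -/
def IsFinite (P : C) : Prop := IsIso (dualToEnd P)

/-- The action `[P, P] ⊗ P* ⟶ P*` by composition. -/
def endActDual (P : C) : (ihom P).obj P ⊗ dual P ⟶ dual P :=
  MonoidalClosed.curry ((α_ P ((ihom P).obj P) (dual P)).inv ≫ evEnd P ▷ dual P ≫ evDual P)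

lemma evDual_condition (P : C) :
    evEnd P ▷ dual P ≫ evDual P =
      ((α_ P ((ihom P).obj P) (dual P)).hom ≫ P ◁ endActDual P) ≫ evDual P := by
  have h : P ◁ endActDual P ≫ evDual P =
      (α_ P ((ihom P).obj P) (dual P)).inv ≫ evEnd P ▷ dual P ≫ evDual P :=
    MonoidalClosed.whiskerLeft_curry_ihom_ev_app _ _ _
  rw [Category.assoc, h, Iso.hom_inv_id_assoc]

/-- The evaluation `P ⊗ P* ⟶ I` as a cofork on the two morphisms `P ⊗ [P, P] ⊗ P* ⇉ P ⊗ P*` whose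
coequalizer is `P ⊗_{[P, P]} P*`. -/
def evCofork (P : C) : Cofork (evEnd P ▷ dual P)
    ((α_ P ((ihom P).obj P) (dual P)).hom ≫ P ◁ endActDual P) :=
  Cofork.ofπ (evDual P) (evDual_condition P)

/-- An object `P` is faithfully projective if it is finite and the evaluation induces an
isomorphism from the tensor product of `P` and `P*` over `[P, P]` to `I`. -/
structure IsFaithfullyProjective (P : C) : Prop where
  finite : IsFinite P
  coequalizer : Nonempty (IsColimit (evCofork P))

variable [BraidedCategory C]

/-- The action `a ⊗ b ⊗ x ↦ a (x b)` of `A ⊗ Aᵒᵖ` on `A`, where `x` and `b` are interchanged by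
the braiding. -/
def leftEnvAct (A : C) [MonObj A] : (A ⊗ A) ⊗ A ⟶ A :=
  (α_ A A A).hom ≫ A ◁ ((β_ A A).hom ≫ μ[A]) ≫ μ[A]

/-- The right action `x ⊗ a ⊗ b ↦ (a x) b` of `Aᵒᵖ ⊗ A` on `A`, where `x` and `a` are interchanged
by the braiding. -/
def rightEnvAct (A : C) [MonObj A] : A ⊗ (A ⊗ A) ⟶ A :=
  (α_ A A A).inv ≫ ((β_ A A).hom ≫ μ[A]) ▷ A ≫ μ[A]

/-- The morphism `A ⊗ Aᵒᵖ ⟶ [A, A]` that corresponds to the action of `A ⊗ Aᵒᵖ` on `A`. -/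
def leftEnvToEnd (A : C) [MonObj A] : A ⊗ A ⟶ (ihom A).obj A :=
  MonoidalClosed.curry ((β_ A (A ⊗ A)).hom ≫ leftEnvAct A)

/-- The morphism `Aᵒᵖ ⊗ A ⟶ [A, A]` that corresponds to the right action of `Aᵒᵖ ⊗ A` on `A`. -/
def rightEnvToEnd (A : C) [MonObj A] : A ⊗ A ⟶ (ihom A).obj A :=
  MonoidalClosed.curry (rightEnvAct A)

/-- An algebra `A` in a closed braided monoidal category is an Azumaya algebra if it is faithfully
projective and the canonical morphisms `A ⊗ Aᵒᵖ ⟶ [A, A]` and `Aᵒᵖ ⊗ A ⟶ [A, A]` are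
isomorphisms. -/
structure IsAzumayaAlgebra (A : C) [MonObj A] : Prop where
  faithfullyProjective : IsFaithfullyProjective A
  isIso_left : IsIso (leftEnvToEnd A)
  isIso_right : IsIso (rightEnvToEnd A)

/-- The invariants `M^A` of an `A`-bimodule `M` with actions `l` and `r`: the equalizer of the two
morphisms `M ⟶ [A, M]` that correspond to `l : A ⊗ M ⟶ M` and to
`A ⊗ M ⟶ M ⊗ A ⟶ M`, the braiding followed by `r`. -/
def invariants [HasEqualizers C] {A M : C} (l : A ⊗ M ⟶ M) (r : M ⊗ A ⟶ M) : C :=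
  equalizer (MonoidalClosed.curry l) (MonoidalClosed.curry ((β_ A M).hom ≫ r))

/-- The embedding `M^A ⟶ M`. -/
def invariantsι [HasEqualizers C] {A M : C} (l : A ⊗ M ⟶ M) (r : M ⊗ A ⟶ M) :
    invariants l r ⟶ M :=
  equalizer.ι _ _

end Azumaya

section Galois

variable [BraidedCategory C]

/-- `ρ` is a right `H`-comodule structure on `T`. -/
structure IsRightComodule (H : C) [ComonObj H] {T : C} (ρ : T ⟶ T ⊗ H) : Prop where
  counit : ρ ≫ T ◁ ε[H] = (ρ_ T).inv
  coassoc : ρ ≫ T ◁ Δ[H] = ρ ≫ ρ ▷ H ≫ (α_ T H H).hom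

/-- `ρ` makes the algebra `T` a right `H`-comodule algebra: it is a right comodule structure and a
morphism of algebras to the braided tensor product `T ⊗ H`. -/
structure IsComoduleAlgebra (H : C) [BimonObj H] (T : C) [MonObj T] (ρ : T ⟶ T ⊗ H) : Prop where
  comodule : IsRightComodule H ρ
  isMonHom : IsMonHom ρ

/-- The canonical morphism `T ⊗ T ⟶ T ⊗ H`, `x ⊗ y ↦ x y₀ ⊗ y₁`, of an `H`-comodule algebra. -/
def can (H : C) (T : C) [MonObj T] (ρ : T ⟶ T ⊗ H) : T ⊗ T ⟶ T ⊗ H :=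
  T ◁ ρ ≫ (α_ T T H).inv ≫ μ[T] ▷ H

/-- `T` with the coaction `ρ` is an `H`-Galois object: a faithfully flat right `H`-comodule algebra
whose canonical morphism is an isomorphism. -/
structure IsGaloisObject (H : C) [BimonObj H] (T : C) [MonObj T] (ρ : T ⟶ T ⊗ H) : Prop where
  comoduleAlgebra : IsComoduleAlgebra H T ρ
  faithfullyFlat : FaithfullyFlat T
  isIso_can : IsIso (can H T ρ)

end Galois

section Smash

variable [BraidedCategory C] {H : C} [BimonObj H]

/-- The underlying algebra in `C` of an `H`-module algebra, that is, of an algebra in the monoidal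
category of `H`-modules. -/
instance underlyingAlgebra (A : Mod C H) [MonObj A] : MonObj A.X where
  one := (η[A] : 𝟙_ (Mod C H) ⟶ A).hom
  mul := (μ[A] : A ⊗ A ⟶ A).hom
  one_mul := congrArg Mod.Hom.hom (MonObj.one_mul A)
  mul_one := congrArg Mod.Hom.hom (MonObj.mul_one A)
  mul_assoc := congrArg Mod.Hom.hom (MonObj.mul_assoc A)

/-- The underlying object `A ⊗ H` of the smash product `A # H`. -/
abbrev smash (A : Mod C H) : C := A.X ⊗ H

variable (A : Mod C H) [MonObj A]

/-- The multiplication `(a # h) (b # k) = a (h₁ b) # h₂ k` of the smash product. -/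
def smashMul : smash A ⊗ smash A ⟶ smash A :=
  (α_ A.X H (A.X ⊗ H)).hom ≫
    A.X ◁ ((α_ H A.X H).inv ≫ entwine H A.X ▷ H ≫ (α_ A.X H H).hom) ≫
      (α_ A.X A.X (H ⊗ H)).inv ≫ (μ[A.X] ⊗ₘ μ[H])

/-- The unit `1 # 1` of the smash product. -/
def smashOne : 𝟙_ C ⟶ smash A := (λ_ (𝟙_ C)).inv ≫ (η[A.X] ⊗ₘ η[H])

/-- The right `H`-coaction `A ⊗ Δ` on the smash product. -/
def smashCoact : smash A ⟶ smash A ⊗ H := A.X ◁ Δ[H] ≫ (α_ A.X H H).inv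

/-- The morphism `A ⟶ A # H`, `a ↦ a # 1`. -/
def smashIncl : A.X ⟶ smash A := (ρ_ A.X).inv ≫ A.X ◁ η[H]

/-- The left `A`-action on `A # H`, by multiplication with `a # 1` from the left. -/
def smashLeftAct : A.X ⊗ smash A ⟶ smash A := smashIncl A ▷ smash A ≫ smashMul A

/-- The right `A`-action on `A # H`, by multiplication with `a # 1` from the right. -/
def smashRightAct : smash A ⊗ A.X ⟶ smash A := smash A ◁ smashIncl A ≫ smashMul A

variable [MonoidalClosed C] [HasEqualizers C]

/-- The invariants `(A # H)^A`. -/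
def smashInvariants : C := invariants (smashLeftAct A) (smashRightAct A)

/-- The embedding `(A # H)^A ⟶ A # H`. -/
def smashInvariantsι : smashInvariants A ⟶ smash A :=
  invariantsι (smashLeftAct A) (smashRightAct A)

end Smash

end BraidedHopf

end

open BraidedHopf

noncomputable section

/-! Write B = A # H. It contains A and H, multiplication gives A ⊗ H ≅ B, and T is the centralizer
of A in B. The forgetful functor from modules to C respects inner homs and evaluations, so A is
finite in C and A ⊗ Aᵒᵖ ≅ [A, A] holds in C. With D = A*, this isomorphism yields ω : D ⟶ A ⊗ A such
that ω(f) acts on A by x ↦ f(x)1 (`exists_isEnvSection`). Since A ⊗ A acts faithfully on A, it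
follows that a ω(f) = ω(f) a, and that Σ eᵢ ω(eⁱ) = 1 ⊗ 1 for the coevaluation Σ eᵢ ⊗ eⁱ. Hence ω(f)
maps every algebra B under A into the centralizer T of A, and b ↦ Σ eᵢ ⊗ ω(eⁱ) b is inverse to the
multiplication A ⊗ T ⟶ B (`isIso_mul_centralizerι`).

Thus A ⊗ T ≅ B ≅ A ⊗ H. Having a dual, A is flat. The functor A ⊗ - reflects isomorphisms, by
faithful projectivity in the module category applied to objects with trivial action
(`reflectsIsomorphisms_of_mod`); so does H ⊗ -, because the counit splits the unit. Hence T is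
faithfully flat. Base change of A ⊗ T ≅ A ⊗ H along A ⟶ B gives B ⊗ T ≅ B ⊗ H; followed by the
isomorphism b ⊗ h ↦ b h₁ ⊗ h₂ it becomes b ⊗ t ↦ b t₀ ⊗ t₁. Up to B ≅ A ⊗ T this is A ⊗ can
(`isIso_whiskerLeft_can`), so can is invertible.

The coaction ρ of B restricts to T because T ⊗ H is still an equalizer, H being flat, and because
ρ(a) = a ⊗ 1. The latter suffices only if moving a past H and back does nothing. This follows from
the linearity of the braiding of a trivial module with the regular module H
(`braiding_braiding_eq_id`). -/

namespace BraidedHopf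

/-! ### Modules over the enveloping algebra A ⊗ Aᵒᵖ. -/

section EnvelopingActions

variable {C : Type u} [Category.{v} C] [MonoidalCategory C] [BraidedCategory C]

/-- `L` is an action of `A` and `R` an action of the opposite algebra on `M`, and the two actions
commute up to the braiding. -/
structure IsEnvModule {A M : C} [MonObj A] (L R : A ⊗ M ⟶ M) : Prop where
  one_left : η[A] ▷ M ≫ L = (λ_ M).hom
  mul_left : μ[A] ▷ M ≫ L = (α_ A A M).hom ≫ A ◁ L ≫ L
  one_right : η[A] ▷ M ≫ R = (λ_ M).hom
  mul_right : ((β_ A A).hom ≫ μ[A]) ▷ M ≫ R = (α_ A A M).hom ≫ A ◁ R ≫ R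
  right_left : A ◁ L ≫ R =
    (α_ A A M).inv ≫ (β_ A A).hom ▷ M ≫ (α_ A A M).hom ≫ A ◁ R ≫ L

/-- The action `a ⊗ b ⊗ m ↦ a m b` of the enveloping algebra. -/
def envAct {A M : C} (L R : A ⊗ M ⟶ M) : (A ⊗ A) ⊗ M ⟶ M :=
  (α_ A A M).hom ≫ A ◁ R ≫ L

lemma leftEnvAct_eq (A : C) [MonObj A] : leftEnvAct A = envAct μ[A] ((β_ A A).hom ≫ μ[A]) := rfl

section

variable {A M : C} [MonObj A] {L R : A ⊗ M ⟶ M}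

lemma IsEnvModule.one_envAct (h : IsEnvModule L R) :
    ((λ_ (𝟙_ C)).inv ≫ (η[A] ⊗ₘ η[A])) ▷ M ≫ envAct L R = (λ_ M).hom := by
  have : ((λ_ (𝟙_ C)).inv ≫ (η[A] ⊗ₘ η[A])) ▷ M ≫ envAct L R =
      (λ_ (𝟙_ C)).inv ▷ M ≫ (α_ (𝟙_ C) (𝟙_ C) M).hom ≫ 𝟙_ C ◁ (η[A] ▷ M ≫ R) ≫ η[A] ▷ M ≫ L := by
    rw [envAct, MonoidalCategory.tensorHom_def']
    simp only [MonoidalCategory.whiskerLeft_comp, comp_whiskerRight, Category.assoc]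
    rw [associator_naturality_left_assoc, ← whisker_exchange_assoc]
    monoidal
  rw [this, h.one_left, h.one_right]
  monoidal

/-- This lemma and the next one translate `L` and `R`, applied after the enveloping action, into
multiplications inside A ⊗ A. Identities there then hold on every M. -/
lemma IsEnvModule.leftMul_envAct (h : IsEnvModule L R) :
    ((α_ A A A).inv ≫ μ[A] ▷ A) ▷ M ≫ envAct L R =
      (α_ A (A ⊗ A) M).hom ≫ A ◁ envAct L R ≫ L := by
  have : ((α_ A A A).inv ≫ μ[A] ▷ A) ▷ M ≫ envAct L R =
      (α_ A (A ⊗ A) M).hom ≫ A ◁ (α_ A A M).hom ≫ (α_ A A (A ⊗ M)).inv ≫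
        (A ⊗ A) ◁ R ≫ μ[A] ▷ M ≫ L := by
    rw [envAct, whisker_exchange_assoc]
    monoidal
  rw [this, h.mul_left, envAct]
  monoidal

/-- By `right_left` the new factor is braided past the left factor, and by `mul_right` it merges
with the right one. -/
lemma IsEnvModule.rightMul_envAct (h : IsEnvModule L R) :
    ((α_ A A A).inv ≫ (β_ A A).hom ▷ A ≫ (α_ A A A).hom ≫ A ◁ ((β_ A A).hom ≫ μ[A])) ▷ M ≫
        envAct L R = (α_ A (A ⊗ A) M).hom ≫ A ◁ envAct L R ≫ R := by
  have e : (A ◁ ((β_ A A).hom ≫ μ[A])) ▷ M ≫ envAct L R =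
      (α_ A (A ⊗ A) M).hom ≫ A ◁ (((β_ A A).hom ≫ μ[A]) ▷ M ≫ R) ≫ L := by
    rw [envAct]; monoidal
  rw [h.mul_right] at e
  have e' : (α_ A (A ⊗ A) M).hom ≫ A ◁ envAct L R ≫ R =
      (α_ A (A ⊗ A) M).hom ≫ A ◁ (α_ A A M).hom ≫ A ◁ A ◁ R ≫ A ◁ L ≫ R := by
    rw [envAct]; monoidal
  rw [e', h.right_left]
  rw [comp_whiskerRight_assoc, comp_whiskerRight_assoc, comp_whiskerRight_assoc, e,
    associator_inv_naturality_right_assoc, whisker_exchange_assoc]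
  monoidal

/-- The enveloping algebra acts on `a m` through its action on `a`, if `m` is invariant. -/
lemma IsEnvModule.envAct_left (h : IsEnvModule L R) {T : C} (j : T ⟶ M)
    (hj : A ◁ j ≫ L = A ◁ j ≫ R) :
    (A ⊗ A) ◁ (A ◁ j ≫ L) ≫ envAct L R =
      (α_ (A ⊗ A) A T).inv ≫ leftEnvAct A ▷ T ≫ A ◁ j ≫ L := by
  have e : (A ⊗ A) ◁ (A ◁ j ≫ L) ≫ envAct L R =
      (α_ A A (A ⊗ T)).hom ≫ A ◁ A ◁ A ◁ j ≫ A ◁ (A ◁ L ≫ R) ≫ L := by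
    rw [envAct]; monoidal
  -- As t is invariant, it can be moved past the new factor: up to braidings, (x t) b = (x b) t, so
  -- `R` acts on x alone.
  have e2 : A ◁ A ◁ j ≫ A ◁ L ≫ R =
      (α_ A A T).inv ≫ ((β_ A A).hom ≫ μ[A]) ▷ T ≫ A ◁ j ≫ L := by
    rw [h.right_left, associator_inv_naturality_right_assoc, whisker_exchange_assoc,
      associator_naturality_right_assoc, ← MonoidalCategory.whiskerLeft_comp_assoc, ← hj,
      ← whisker_exchange_assoc, comp_whiskerRight_assoc, h.mul_left,
      whisker_exchange_assoc]
    monoidal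
  have e3 : (α_ (A ⊗ A) A T).inv ≫ leftEnvAct A ▷ T ≫ A ◁ j ≫ L =
      (α_ A A (A ⊗ T)).hom ≫ A ◁ (α_ A A T).inv ≫ A ◁ ((β_ A A).hom ≫ μ[A]) ▷ T ≫
        (α_ A A T).inv ≫ (A ⊗ A) ◁ j ≫ μ[A] ▷ M ≫ L := by
    rw [leftEnvAct, whisker_exchange_assoc]
    monoidal
  rw [e, ← MonoidalCategory.whiskerLeft_comp_assoc A (A ◁ A ◁ j), e2, e3, h.mul_left]
  monoidal

end

/-- A morphism of algebras `A ⟶ B` makes `B` a module over the enveloping algebra of `A`. -/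
lemma isEnvModule_of_isMonHom {A B : C} [MonObj A] [MonObj B] (i : A ⟶ B) [IsMonHom i] :
    IsEnvModule (i ▷ B ≫ μ[B]) ((β_ A B).hom ≫ B ◁ i ≫ μ[B]) where
  one_left := by
    rw [← comp_whiskerRight_assoc, IsMonHom.one_hom, MonObj.one_mul]
  mul_left := by
    rw [← comp_whiskerRight_assoc, IsMonHom.mul_hom, MonoidalCategory.tensorHom_def']
    simp only [comp_whiskerRight, Category.assoc, MonObj.mul_assoc]
    rw [MonoidalCategory.whiskerLeft_comp_assoc, whisker_exchange_assoc,
      associator_naturality_left_assoc, associator_naturality_middle_assoc]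
  one_right := by
    rw [BraidedCategory.braiding_naturality_left_assoc,
      ← MonoidalCategory.whiskerLeft_comp_assoc, IsMonHom.one_hom, MonObj.mul_one]
    simp
  mul_right := by
    have e : (α_ A A B).hom ≫ A ◁ ((β_ A B).hom ≫ B ◁ i ≫ μ[B]) ≫ (β_ A B).hom ≫ B ◁ i ≫ μ[B] =
        (β_ (A ⊗ A) B).hom ≫ B ◁ (β_ A A).hom ≫ (α_ B A A).inv ≫ ((B ◁ i) ▷ A) ≫
          (B ⊗ B) ◁ i ≫ μ[B] ▷ B ≫ μ[B] := by
      rw [MonoidalCategory.whiskerLeft_comp_assoc, BraidedCategory.braiding_naturality_right_assoc,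
        BraidedCategory.braiding_tensor_right_hom, BraidedCategory.braiding_tensor_left_hom,
        whisker_exchange_assoc]
      monoidal
    rw [e, ← BraidedCategory.braiding_naturality_left_assoc (β_ A A).hom, comp_whiskerRight_assoc,
      BraidedCategory.braiding_naturality_left_assoc, ← MonoidalCategory.whiskerLeft_comp_assoc,
      IsMonHom.mul_hom, MonObj.mul_assoc, MonoidalCategory.tensorHom_def]
    monoidal
  right_left := by
    have e : (α_ A A B).inv ≫ (β_ A A).hom ▷ B ≫ (α_ A A B).hom ≫
        A ◁ ((β_ A B).hom ≫ B ◁ i ≫ μ[B]) ≫ i ▷ B ≫ μ[B] =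
        (α_ A A B).inv ≫ ((β_ A A).hom ≫ i ▷ A) ▷ B ≫ (α_ B A B).hom ≫
          B ◁ (β_ A B).hom ≫ B ◁ B ◁ i ≫ B ◁ μ[B] ≫ μ[B] := by
      rw [whisker_exchange_assoc]
      monoidal
    rw [e, ← BraidedCategory.braiding_naturality_right, MonoidalCategory.whiskerLeft_comp_assoc,
      BraidedCategory.braiding_naturality_right_assoc, BraidedCategory.braiding_tensor_right_hom,
      ← whisker_exchange_assoc, MonObj.mul_assoc]
    monoidal

end EnvelopingActions

/-! ### Splitting off A from its modules by means of ω. -/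

section Separability

variable {C : Type u} [Category.{v} C] [MonoidalCategory C] [BraidedCategory C]

lemma isEnvModule_self (A : C) [MonObj A] : IsEnvModule μ[A] ((β_ A A).hom ≫ μ[A]) := by
  simpa using isEnvModule_of_isMonHom (𝟙 A)

/-- A morphism `D ⟶ A ⊗ A` from a dual `D` of `A`, which represents the endomorphisms
`x ↦ f(x) 1` of `A` by elements of the enveloping algebra, where this algebra acts faithfully. -/
structure IsEnvSection {A D : C} [MonObj A] [ExactPairing A D] (ω : D ⟶ A ⊗ A) : Prop where
  act : ω ▷ A ≫ leftEnvAct A = ε_ A D ≫ η[A]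
  faithful {X : C} (f g : X ⟶ A ⊗ A) (h : f ▷ A ≫ leftEnvAct A = g ▷ A ≫ leftEnvAct A) : f = g

namespace IsEnvSection

variable {A D : C} [MonObj A] [ExactPairing A D] {ω : D ⟶ A ⊗ A}

/-- Both sides act on A by x ↦ f(x) a, once as a·1 and once as 1·a, and the action is faithful. -/
lemma leftMul_eq_rightMul (hω : IsEnvSection ω) :
    A ◁ ω ≫ (α_ A A A).inv ≫ μ[A] ▷ A =
      A ◁ ω ≫ (α_ A A A).inv ≫ (β_ A A).hom ▷ A ≫ (α_ A A A).hom ≫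
        A ◁ ((β_ A A).hom ≫ μ[A]) := by
  apply hω.faithful
  have e (f : A ⊗ (A ⊗ A) ⟶ A ⊗ A) (L : A ⊗ A ⟶ A)
      (h : f ▷ A ≫ leftEnvAct A = (α_ A (A ⊗ A) A).hom ≫ A ◁ leftEnvAct A ≫ L) :
      (A ◁ ω ≫ f) ▷ A ≫ leftEnvAct A =
        (α_ A D A).hom ≫ A ◁ ε_ A D ≫ A ◁ η[A] ≫ L := by
    rw [comp_whiskerRight_assoc, h, associator_naturality_middle_assoc,
      ← MonoidalCategory.whiskerLeft_comp_assoc, hω.act, MonoidalCategory.whiskerLeft_comp_assoc]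
  rw [e _ _ (isEnvModule_self A).leftMul_envAct, e _ _ (isEnvModule_self A).rightMul_envAct]
  simp

/-- The left side acts on A by x ↦ Σ eᵢ eⁱ(x) = x, so it must be the unit of the enveloping algebra.
-/
lemma coev_mul (hω : IsEnvSection ω) :
    η_ A D ≫ A ◁ ω ≫ (α_ A A A).inv ≫ μ[A] ▷ A = (λ_ (𝟙_ C)).inv ≫ (η[A] ⊗ₘ η[A]) := by
  apply hω.faithful
  rw [leftEnvAct_eq, (isEnvModule_self A).one_envAct, comp_whiskerRight_assoc,
    comp_whiskerRight_assoc, (isEnvModule_self A).leftMul_envAct,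
    associator_naturality_middle_assoc, ← MonoidalCategory.whiskerLeft_comp_assoc,
    ← leftEnvAct_eq, hω.act, MonoidalCategory.whiskerLeft_comp_assoc, MonObj.mul_one,
    ExactPairing.evaluation_coevaluation_assoc]
  simp

variable {M : C} {L R : A ⊗ M ⟶ M}

/-- This is why ω projects M into its invariants: the identity a ω(f) = ω(f) a in A ⊗ A is carried
over to M. -/
lemma left_eq_right (hω : IsEnvSection ω) (h : IsEnvModule L R) :
    A ◁ (ω ▷ M ≫ envAct L R) ≫ L = A ◁ (ω ▷ M ≫ envAct L R) ≫ R := by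
  have e (f : A ⊗ (A ⊗ A) ⟶ A ⊗ A) (K : A ⊗ M ⟶ M)
      (h : f ▷ M ≫ envAct L R = (α_ A (A ⊗ A) M).hom ≫ A ◁ envAct L R ≫ K) :
      A ◁ (ω ▷ M ≫ envAct L R) ≫ K = (α_ A D M).inv ≫ (A ◁ ω ≫ f) ▷ M ≫ envAct L R := by
    rw [comp_whiskerRight_assoc, h]
    monoidal
  rw [e _ _ h.leftMul_envAct, hω.leftMul_eq_rightMul, ← e _ _ h.rightMul_envAct]

/-- If `j : T ⟶ M` is the embedding of the invariants, then `A ⊗ T ⟶ M`, `a ⊗ t ↦ a t`, is an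
isomorphism. -/
lemma isIso_whiskerLeft_comp (hω : IsEnvSection ω) (h : IsEnvModule L R) {T : C} (j : T ⟶ M)
    [Mono j] (hj : A ◁ j ≫ L = A ◁ j ≫ R)
    (k : D ⊗ M ⟶ T) (hk : k ≫ j = ω ▷ M ≫ envAct L R) : IsIso (A ◁ j ≫ L) := by
  -- On a product a t with t invariant, ω(f) acts through a only and gives f(a) t.
  have hk' : D ◁ (A ◁ j ≫ L) ≫ k = (α_ D A T).inv ≫ ε_ A D ▷ T ≫ (λ_ T).hom := by
    rw [← cancel_mono j, Category.assoc, hk, whisker_exchange_assoc, h.envAct_left j hj,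
      associator_inv_naturality_left_assoc, ← comp_whiskerRight_assoc, hω.act,
      comp_whiskerRight_assoc, ← whisker_exchange_assoc, h.one_left]
    simp
  -- The inverse is m ↦ Σ eᵢ ⊗ ω(eⁱ) m. One composite is a zigzag identity by `hk'`, the other is
  -- `coev_mul`.
  refine ⟨(λ_ M).inv ≫ η_ A D ▷ M ≫ (α_ A D M).hom ≫ A ◁ k, ?_, ?_⟩
  · have e : (A ◁ j ≫ L) ≫ (λ_ M).inv ≫ η_ A D ▷ M ≫ (α_ A D M).hom ≫ A ◁ k =
        (λ_ (A ⊗ T)).inv ≫ η_ A D ▷ (A ⊗ T) ≫ (α_ A D (A ⊗ T)).hom ≫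
          A ◁ (D ◁ (A ◁ j ≫ L) ≫ k) := by
      rw [leftUnitor_inv_naturality_assoc, whisker_exchange_assoc]
      monoidal
    have e' : (λ_ (A ⊗ T)).inv ≫ η_ A D ▷ (A ⊗ T) ≫ (α_ A D (A ⊗ T)).hom ≫
        A ◁ ((α_ D A T).inv ≫ ε_ A D ▷ T ≫ (λ_ T).hom) =
        (λ_ A).inv ▷ T ≫ (η_ A D ▷ A ≫ (α_ A D A).hom ≫ A ◁ ε_ A D) ▷ T ≫
          (α_ _ _ _).hom ≫ A ◁ (λ_ T).hom := by
      monoidal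
    rw [e, hk', e', ExactPairing.evaluation_coevaluation]
    monoidal
  · have e : (λ_ M).inv ≫ η_ A D ▷ M ≫ (α_ A D M).hom ≫ A ◁ (ω ▷ M ≫ envAct L R) ≫ L =
        (λ_ M).inv ≫ (η_ A D ≫ A ◁ ω ≫ (α_ A A A).inv ≫ μ[A] ▷ A) ▷ M ≫ envAct L R := by
      have := h.leftMul_envAct
      simp only [comp_whiskerRight, Category.assoc] at this ⊢
      rw [this]
      monoidal
    simp only [Category.assoc]
    rw [← MonoidalCategory.whiskerLeft_comp_assoc, hk, e, hω.coev_mul, h.one_envAct,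
      Iso.inv_hom_id]

end IsEnvSection

end Separability

/-! ### Finite objects have duals. -/

section Finite

variable {C : Type u} [Category.{v} C] [MonoidalCategory C] [MonoidalClosed C]

/-- The coevaluation is the preimage of the identity of P under P* ⊗ P ≅ [P, P]. -/
lemma IsFinite.exists_coev {P : C} (h : IsFinite P) :
    ∃ c : 𝟙_ C ⟶ dual P ⊗ P,
      P ◁ c ≫ (α_ P (dual P) P).inv ≫ evDual P ▷ P = (ρ_ P).hom ≫ (λ_ P).inv := by
  have := h
  rw [IsFinite] at this
  refine ⟨MonoidalClosed.curry (ρ_ P).hom ≫ inv (dualToEnd P), ?_⟩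
  have e : P ◁ dualToEnd P ≫ (ihom.ev P).app P =
      (α_ P (dual P) P).inv ≫ evDual P ▷ P ≫ (λ_ P).hom :=
    MonoidalClosed.whiskerLeft_curry_ihom_ev_app _ _ _
  rw [← cancel_mono (λ_ P).hom]
  simp only [Category.assoc, Iso.inv_hom_id, Category.comp_id]
  rw [← e, ← MonoidalCategory.whiskerLeft_comp_assoc, Category.assoc, IsIso.inv_hom_id,
    Category.comp_id, MonoidalClosed.whiskerLeft_curry_ihom_ev_app]

/-- A finite object has a dual. -/
abbrev IsFinite.exactPairing {P : C} (h : IsFinite P) : ExactPairing (dual P) P where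
  coevaluation' := h.exists_coev.choose
  evaluation' := evDual P
  coevaluation_evaluation' := h.exists_coev.choose_spec
  evaluation_coevaluation' := by
    generalize_proofs p
    have hc := p.choose_spec
    generalize p.choose = c at hc
    rw [← cancel_mono (ρ_ _).hom]
    -- A morphism to P* is determined by its pairing with P, so the second zigzag identity follows
    -- from the first.
    apply MonoidalClosed.uncurry_injective
    simp only [MonoidalClosed.uncurry_eq]
    change P ◁ _ ≫ evDual P = P ◁ _ ≫ evDual P
    have e : P ◁ ((c ▷ dual P ≫ (α_ (dual P) P (dual P)).hom ≫ dual P ◁ evDual P) ≫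
        (ρ_ (dual P)).hom) ≫ evDual P = (α_ P (𝟙_ C) (dual P)).inv ≫
        (P ◁ c ≫ (α_ P (dual P) P).inv) ▷ dual P ≫ (α_ (P ⊗ dual P) P (dual P)).hom ≫
          (P ⊗ dual P) ◁ evDual P ≫ evDual P ▷ 𝟙_ C ≫ (ρ_ (𝟙_ C)).hom := by
      monoidal
    have e' : (α_ P (𝟙_ C) (dual P)).inv ≫
        (P ◁ c ≫ (α_ P (dual P) P).inv) ▷ dual P ≫ (α_ (P ⊗ dual P) P (dual P)).hom ≫
          evDual P ▷ (P ⊗ dual P) ≫ 𝟙_ C ◁ evDual P ≫ (ρ_ (𝟙_ C)).hom =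
        (α_ P (𝟙_ C) (dual P)).inv ≫
        (P ◁ c ≫ (α_ P (dual P) P).inv ≫ evDual P ▷ P) ▷ dual P ≫ (α_ (𝟙_ C) P (dual P)).hom ≫
          𝟙_ C ◁ evDual P ≫ (ρ_ (𝟙_ C)).hom := by
      monoidal
    rw [e, whisker_exchange_assoc, e', hc]
    monoidal

end Finite

/-! ### The element ω of an Azumaya algebra. -/

section Azumaya

variable {C : Type u} [Category.{v} C] [MonoidalCategory C] [MonoidalClosed C] [BraidedCategory C]

/-- The dual of a finite object in a braided category is also a dual on the other side, by means of
the inverse of the braiding. -/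
abbrev IsFinite.exactPairing' {P : C} (h : IsFinite P) : ExactPairing P (dual P) :=
  letI := h.exactPairing
  @BraidedCategory.exactPairing_swap C _ _ (reverseBraiding C) (dual P) P _

/-- The canonical morphism `A ⊗ Aᵒᵖ ⟶ [A, A]` of an Azumaya algebra yields a morphism from the dual
of `A` that represents the endomorphisms `x ↦ f(x) 1`. -/
lemma exists_isEnvSection {A : C} [MonObj A] (hA : IsFinite A) (h : IsIso (leftEnvToEnd A)) :
    letI := hA.exactPairing'
    ∃ ω : dual A ⟶ A ⊗ A, IsEnvSection ω := by
  let := hA.exactPairing'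
  have e {X : C} (f : X ⟶ A ⊗ A) : A ◁ (f ≫ leftEnvToEnd A) ≫ (ihom.ev A).app A =
      (β_ A X).hom ≫ f ▷ A ≫ leftEnvAct A := by
    rw [MonoidalCategory.whiskerLeft_comp_assoc, leftEnvToEnd,
      MonoidalClosed.whiskerLeft_curry_ihom_ev_app,
      BraidedCategory.braiding_naturality_right_assoc]
  -- The family of endomorphisms x ↦ f(x) 1, pulled back to A ⊗ A.
  refine ⟨MonoidalClosed.curry (evDual A ≫ η[A]) ≫ inv (leftEnvToEnd A), ?_, ?_⟩
  · rw [← cancel_epi (β_ A (dual A)).hom, ← e, Category.assoc, IsIso.inv_hom_id, Category.comp_id,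
      MonoidalClosed.whiskerLeft_curry_ihom_ev_app]
    -- The pairing D ⊗ A ⟶ I was built with the inverse braiding, which cancels the braiding in
    -- `leftEnvToEnd`.
    change _ = (β_ A (dual A)).hom ≫ ((β_ A (dual A)).inv ≫ evDual A) ≫ η[A]
    simp
  · intro X f g hfg
    rw [← cancel_mono (leftEnvToEnd A)]
    apply MonoidalClosed.uncurry_injective
    rw [MonoidalClosed.uncurry_eq, MonoidalClosed.uncurry_eq, e, e, hfg]

end Azumaya

/-! ### The universal property of the invariants. -/

section Invariants

variable {C : Type u} [Category.{v} C] [MonoidalCategory C] [MonoidalClosed C]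

lemma comp_curry_eq_iff {A M N X : C} (f : X ⟶ M) (p q : A ⊗ M ⟶ N) :
    f ≫ MonoidalClosed.curry p = f ≫ MonoidalClosed.curry q ↔ A ◁ f ≫ p = A ◁ f ≫ q := by
  rw [← MonoidalClosed.curry_natural_left, ← MonoidalClosed.curry_natural_left]
  exact MonoidalClosed.curry_injective.eq_iff

variable [BraidedCategory C] [HasEqualizers C] {A M : C} (l : A ⊗ M ⟶ M) (r : M ⊗ A ⟶ M)

instance : Mono (invariantsι l r) := inferInstanceAs (Mono (equalizer.ι _ _))

lemma invariantsι_condition :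
    A ◁ invariantsι l r ≫ l = A ◁ invariantsι l r ≫ (β_ A M).hom ≫ r :=
  (comp_curry_eq_iff _ _ _).1 (equalizer.condition _ _)

variable {l r} in
/-- A morphism to a bimodule that is invariant factors through the invariants. -/
def invariantsLift {X : C} (f : X ⟶ M) (h : A ◁ f ≫ l = A ◁ f ≫ (β_ A M).hom ≫ r) :
    X ⟶ invariants l r :=
  equalizer.lift f ((comp_curry_eq_iff _ _ _).2 h)

lemma invariantsLift_ι {X : C} (f : X ⟶ M) (h : A ◁ f ≫ l = A ◁ f ≫ (β_ A M).hom ≫ r) :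
    invariantsLift f h ≫ invariantsι l r = f :=
  equalizer.lift_ι _ _

end Invariants

/-! ### Centralizers as subalgebras, and the factorization B ≅ A ⊗ T. -/

section Centralizer

variable {C : Type u} [Category.{v} C] [MonoidalCategory C]

/-- The structure of an algebra on a subobject of an algebra that contains the unit and is closed
under multiplication. -/
abbrev monObjOfMono {B T : C} [MonObj B] (j : T ⟶ B) [Mono j] (e : 𝟙_ C ⟶ T) (m : T ⊗ T ⟶ T)
    (he : e ≫ j = η[B]) (hm : m ≫ j = (j ⊗ₘ j) ≫ μ[B]) : MonObj T where
  one := e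
  mul := m
  one_mul := by
    rw [← cancel_mono j, Category.assoc, hm, ← tensorHom_id, tensorHom_comp_tensorHom_assoc, he]
    simp [MonoidalCategory.tensorHom_def']
  mul_one := by
    rw [← cancel_mono j, Category.assoc, hm, ← id_tensorHom, tensorHom_comp_tensorHom_assoc, he]
    simp [MonoidalCategory.tensorHom_def]
  mul_assoc := by
    rw [← cancel_mono j]
    simp only [Category.assoc, hm]
    rw [← tensorHom_id, ← id_tensorHom, tensorHom_comp_tensorHom_assoc,
      tensorHom_comp_tensorHom_assoc, hm, Category.id_comp,
      MonoidalCategory.tensorHom_def, comp_whiskerRight_assoc, Category.assoc, Category.assoc,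
      ← whisker_exchange_assoc, MonObj.mul_assoc, MonoidalCategory.tensorHom_def j,
      MonoidalCategory.tensorHom_def j]
    monoidal

variable [BraidedCategory C] {A B : C} [MonObj B] (i : A ⟶ B)

/-- The morphism `f : X ⟶ B` commutes with `i : A ⟶ B`. -/
def Centralizes {X : C} (f : X ⟶ B) : Prop :=
  A ◁ f ≫ i ▷ B ≫ μ[B] = A ◁ f ≫ (β_ A B).hom ≫ B ◁ i ≫ μ[B]

lemma centralizes_one : Centralizes i η[B] := by
  rw [Centralizes, whisker_exchange_assoc, MonObj.mul_one,
    BraidedCategory.braiding_naturality_right_assoc, ← whisker_exchange_assoc, MonObj.one_mul]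
  simp

variable {i} in
-- The factor from A is moved past f and then past g; the hexagon identity joins the two braidings.
lemma Centralizes.mul {X Y : C} {f : X ⟶ B} {g : Y ⟶ B} (hf : Centralizes i f)
    (hg : Centralizes i g) : Centralizes i ((f ⊗ₘ g) ≫ μ[B]) := by
  rw [Centralizes, BraidedCategory.braiding_naturality_right_assoc] at *
  have e1 : A ◁ ((f ⊗ₘ g) ≫ μ[B]) ≫ i ▷ B ≫ μ[B] =
      (α_ A X Y).inv ≫ (A ◁ f ≫ i ▷ B ≫ μ[B]) ▷ Y ≫ B ◁ g ≫ μ[B] := by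
    simp only [comp_whiskerRight, Category.assoc]
    rw [← whisker_exchange_assoc, MonObj.mul_assoc, MonoidalCategory.whiskerLeft_comp_assoc,
      whisker_exchange_assoc, MonoidalCategory.tensorHom_def,
      MonoidalCategory.whiskerLeft_comp_assoc, whisker_exchange_assoc]
    monoidal
  have e2 : (α_ A X Y).inv ≫ ((β_ A X).hom ≫ f ▷ A ≫ B ◁ i ≫ μ[B]) ▷ Y ≫ B ◁ g ≫ μ[B] =
      (α_ A X Y).inv ≫ (β_ A X).hom ▷ Y ≫ (α_ X A Y).hom ≫
        X ◁ (A ◁ g ≫ i ▷ B ≫ μ[B]) ≫ f ▷ B ≫ μ[B] := by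
    simp only [comp_whiskerRight, Category.assoc]
    rw [← whisker_exchange_assoc, MonObj.mul_assoc, whisker_exchange_assoc f,
      whisker_exchange_assoc i]
    monoidal
  rw [e1, hf, e2, hg, BraidedCategory.braiding_tensor_right_hom]
  simp only [MonoidalCategory.whiskerLeft_comp, comp_whiskerRight, Category.assoc,
    MonoidalCategory.tensorHom_def]
  rw [whisker_exchange_assoc, whisker_exchange_assoc, whisker_exchange_assoc,
    ← whisker_exchange_assoc μ[B], MonObj.mul_assoc]
  monoidal

variable [MonoidalClosed C] [HasEqualizers C]

/-- The centralizer of `i : A ⟶ B`. -/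
abbrev centralizer : C := invariants (i ▷ B ≫ μ[B]) (B ◁ i ≫ μ[B])

/-- The embedding of the centralizer. -/
abbrev centralizerι : centralizer i ⟶ B := invariantsι (i ▷ B ≫ μ[B]) (B ◁ i ≫ μ[B])

lemma centralizes_ι : Centralizes i (centralizerι i) := invariantsι_condition _ _

/-- The centralizer of a morphism is a subalgebra. -/
abbrev centralizerMonObj : MonObj (centralizer i) :=
  monObjOfMono (centralizerι i) (invariantsLift η[B] (centralizes_one i))
    (invariantsLift _ ((centralizes_ι i).mul (centralizes_ι i)))
    (invariantsLift_ι _ _ _ _) (invariantsLift_ι _ _ _ _)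

lemma isMonHom_centralizerι :
    letI := centralizerMonObj i
    IsMonHom (centralizerι i) :=
  letI := centralizerMonObj i
  { one_hom := invariantsLift_ι _ _ _ _
    mul_hom := invariantsLift_ι _ _ _ _ }

variable [MonObj A] [IsMonHom i]

/-- Over an Azumaya algebra `A`, every algebra `B` with a morphism `i : A ⟶ B` is the product of
`A` and the centralizer of `i`. -/
lemma isIso_mul_centralizerι (hA : IsFinite A) (h : IsIso (leftEnvToEnd A)) :
    IsIso (A ◁ centralizerι i ≫ i ▷ B ≫ μ[B]) := by
  let := hA.exactPairing'
  obtain ⟨ω, hω⟩ := exists_isEnvSection hA h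
  have hB := isEnvModule_of_isMonHom i
  exact hω.isIso_whiskerLeft_comp hB _ (centralizes_ι i)
    (invariantsLift _ (hω.left_eq_right hB)) (invariantsLift_ι _ _ _ _)

end Centralizer

/-! ### Algebra structures on A ⊗ H from distributive laws. -/

section DistributiveLaw

variable {C : Type u} [Category.{v} C] [MonoidalCategory C] {A H : C} [MonObj A] [MonObj H]

/-- A distributive law between two algebras. -/
class IsDistributiveLaw (ψ : H ⊗ A ⟶ A ⊗ H) : Prop where
  one_left : η[H] ▷ A ≫ ψ = (λ_ A).hom ≫ (ρ_ A).inv ≫ A ◁ η[H]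
  one_right : H ◁ η[A] ≫ ψ = (ρ_ H).hom ≫ (λ_ H).inv ≫ η[A] ▷ H
  mul_left : μ[H] ▷ A ≫ ψ = (α_ H H A).hom ≫ H ◁ ψ ≫ (α_ H A H).inv ≫
    ψ ▷ H ≫ (α_ A H H).hom ≫ A ◁ μ[H]
  mul_right : H ◁ μ[A] ≫ ψ = (α_ H A A).inv ≫ ψ ▷ A ≫ (α_ A H A).hom ≫
    A ◁ ψ ≫ (α_ A A H).inv ≫ μ[A] ▷ H

variable (ψ : H ⊗ A ⟶ A ⊗ H)

/-- The multiplication on `A ⊗ H` defined by a distributive law. -/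
def twistMul : (A ⊗ H) ⊗ (A ⊗ H) ⟶ A ⊗ H :=
  (α_ A H (A ⊗ H)).hom ≫ A ◁ ((α_ H A H).inv ≫ ψ ▷ H ≫ (α_ A H H).hom) ≫
    (α_ A A (H ⊗ H)).inv ≫ (μ[A] ⊗ₘ μ[H])

/-- The right action of `A` on `A ⊗ H` defined by a distributive law. -/
def twistAct : (A ⊗ H) ⊗ A ⟶ A ⊗ H :=
  (α_ A H A).hom ≫ A ◁ ψ ≫ (α_ A A H).inv ≫ μ[A] ▷ H

/-- Multiplying by a ⊗ h from the right means acting by a and then by h, so associativity becomes a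
statement about two right actions. -/
lemma twistMul_eq : twistMul ψ =
    (α_ (A ⊗ H) A H).inv ≫ twistAct ψ ▷ H ≫ (α_ A H H).hom ≫ A ◁ μ[H] := by
  rw [twistMul, twistAct, MonoidalCategory.tensorHom_def]
  monoidal

variable [IsDistributiveLaw ψ]

lemma one_twistAct : (A ⊗ H) ◁ η[A] ≫ twistAct ψ = (ρ_ (A ⊗ H)).hom := by
  have e : (A ⊗ H) ◁ η[A] ≫ twistAct ψ = (α_ A H (𝟙_ C)).hom ≫ A ◁ (H ◁ η[A] ≫ ψ) ≫
      (α_ A A H).inv ≫ μ[A] ▷ H := by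
    rw [twistAct]; monoidal
  have e' : (α_ A H (𝟙_ C)).hom ≫ A ◁ ((ρ_ H).hom ≫ (λ_ H).inv ≫ η[A] ▷ H) ≫
      (α_ A A H).inv ≫ μ[A] ▷ H = (ρ_ (A ⊗ H)).hom ≫ (ρ_ A).inv ▷ H ≫ (A ◁ η[A] ≫ μ[A]) ▷ H := by
    monoidal
  rw [e, IsDistributiveLaw.one_right, e', MonObj.mul_one]
  simp

lemma mul_twistAct : (A ⊗ H) ◁ μ[A] ≫ twistAct ψ =
    (α_ (A ⊗ H) A A).inv ≫ twistAct ψ ▷ A ≫ twistAct ψ := by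
  have e : (A ⊗ H) ◁ μ[A] ≫ twistAct ψ = (α_ A H (A ⊗ A)).hom ≫ A ◁ (H ◁ μ[A] ≫ ψ) ≫
      (α_ A A H).inv ≫ μ[A] ▷ H := by
    rw [twistAct]; monoidal
  have e' : (α_ A H (A ⊗ A)).hom ≫ A ◁ ((α_ H A A).inv ≫ ψ ▷ A ≫ (α_ A H A).hom ≫
      A ◁ ψ ≫ (α_ A A H).inv ≫ μ[A] ▷ H) ≫ (α_ A A H).inv ≫ μ[A] ▷ H =
      (α_ A H (A ⊗ A)).hom ≫ A ◁ ((α_ H A A).inv ≫ ψ ▷ A ≫ (α_ A H A).hom ≫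
      A ◁ ψ ≫ (α_ A A H).inv) ≫ (α_ A (A ⊗ A) H).inv ≫ (A ◁ μ[A] ≫ μ[A]) ▷ H := by
    monoidal
  have e2 : A ◁ μ[A] ≫ μ[A] = (α_ A A A).inv ≫ μ[A] ▷ A ≫ μ[A] := by simp
  have e3 : (α_ (A ⊗ H) A A).inv ≫ twistAct ψ ▷ A ≫ twistAct ψ =
    (α_ (A ⊗ H) A A).inv ≫ ((α_ A H A).hom ≫ A ◁ ψ ≫ (α_ A A H).inv) ▷ A ≫
      (α_ (A ⊗ A) H A).hom ≫ μ[A] ▷ (H ⊗ A) ≫ A ◁ ψ ≫ (α_ A A H).inv ≫ μ[A] ▷ H := by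
    rw [twistAct]; monoidal
  rw [e, IsDistributiveLaw.mul_right, e', e2, e3, ← whisker_exchange_assoc]
  monoidal

/-- The exchange rule of the two right actions: acting by h and then by a is acting by ψ(h ⊗ a). -/
lemma mul_act_twistAct : ((α_ A H H).hom ≫ A ◁ μ[H]) ▷ A ≫ twistAct ψ =
    (α_ (A ⊗ H) H A).hom ≫ (A ⊗ H) ◁ ψ ≫ (α_ (A ⊗ H) A H).inv ≫ twistAct ψ ▷ H ≫
      (α_ A H H).hom ≫ A ◁ μ[H] := by
  have e : ((α_ A H H).hom ≫ A ◁ μ[H]) ▷ A ≫ twistAct ψ =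
      (α_ A H H).hom ▷ A ≫ (α_ A (H ⊗ H) A).hom ≫ A ◁ (μ[H] ▷ A ≫ ψ) ≫
        (α_ A A H).inv ≫ μ[A] ▷ H := by
    rw [twistAct]; monoidal
  have e' : (α_ A H H).hom ▷ A ≫ (α_ A (H ⊗ H) A).hom ≫ A ◁ ((α_ H H A).hom ≫ H ◁ ψ ≫
      (α_ H A H).inv ≫ ψ ▷ H ≫ (α_ A H H).hom ≫ A ◁ μ[H]) ≫ (α_ A A H).inv ≫ μ[A] ▷ H =
      (α_ A H H).hom ▷ A ≫ (α_ A (H ⊗ H) A).hom ≫ A ◁ ((α_ H H A).hom ≫ H ◁ ψ ≫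
      (α_ H A H).inv ≫ ψ ▷ H ≫ (α_ A H H).hom) ≫ (α_ A A (H ⊗ H)).inv ≫
        (A ⊗ A) ◁ μ[H] ≫ μ[A] ▷ H := by
    monoidal
  rw [e, IsDistributiveLaw.mul_left, e', whisker_exchange, twistAct]
  monoidal

/-- Both sides let a, h, a', h' act in turn on A ⊗ H. The exchange rule swaps h and a'; the module
axioms then merge the two factors from A and the two from H. -/
lemma twistMul_assoc :
    twistMul ψ ▷ (A ⊗ H) ≫ twistMul ψ =
      (α_ (A ⊗ H) (A ⊗ H) (A ⊗ H)).hom ≫ (A ⊗ H) ◁ twistMul ψ ≫ twistMul ψ := by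
  obtain ⟨r, hr⟩ : ∃ r, r = (α_ A H H).hom ≫ A ◁ μ[H] := ⟨_, rfl⟩
  have h1 : r ▷ A ≫ twistAct ψ = (α_ (A ⊗ H) H A).hom ≫ (A ⊗ H) ◁ ψ ≫ (α_ (A ⊗ H) A H).inv ≫
      twistAct ψ ▷ H ≫ r := by
    rw [hr, mul_act_twistAct]
  have h2 : twistAct ψ ▷ A ≫ twistAct ψ = (α_ (A ⊗ H) A A).hom ≫ (A ⊗ H) ◁ μ[A] ≫ twistAct ψ := by
    rw [mul_twistAct]; simp
  have h3 : r ▷ H ≫ r = (α_ (A ⊗ H) H H).hom ≫ (A ⊗ H) ◁ μ[H] ≫ r := by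
    have e : r ▷ H ≫ r = (α_ A H H).hom ▷ H ≫ (α_ A (H ⊗ H) H).hom ≫ A ◁ (μ[H] ▷ H ≫ μ[H]) := by
      rw [hr]; monoidal
    rw [e, MonObj.mul_assoc, hr]
    monoidal
  have h : twistMul ψ = (α_ (A ⊗ H) A H).inv ≫ twistAct ψ ▷ H ≫ r := by rw [hr, twistMul_eq]
  have e1 : twistMul ψ ▷ (A ⊗ H) ≫ twistMul ψ =
      (α_ (A ⊗ H) A H).inv ▷ (A ⊗ H) ≫ (α_ ((A ⊗ H) ⊗ A) H (A ⊗ H)).hom ≫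
        ((A ⊗ H) ⊗ A) ◁ ((α_ H A H).inv ≫ ψ ▷ H ≫ (α_ A H H).hom) ≫
          (α_ ((A ⊗ H) ⊗ A) A (H ⊗ H)).inv ≫ (twistAct ψ ▷ A ≫ twistAct ψ) ▷ (H ⊗ H) ≫
            (α_ (A ⊗ H) H H).inv ≫ r ▷ H ≫ r := by
    have e : twistMul ψ ▷ (A ⊗ H) ≫ twistMul ψ =
        (α_ (A ⊗ H) A H).inv ▷ (A ⊗ H) ≫ twistAct ψ ▷ H ▷ (A ⊗ H) ≫ (α_ ((A ⊗ H) ⊗ H) A H).inv ≫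
          (r ▷ A ≫ twistAct ψ) ▷ H ≫ r := by
      rw [h]; monoidal
    have e' : (α_ (A ⊗ H) A H).inv ▷ (A ⊗ H) ≫ twistAct ψ ▷ H ▷ (A ⊗ H) ≫
        (α_ ((A ⊗ H) ⊗ H) A H).inv ≫ ((α_ (A ⊗ H) H A).hom ≫ (A ⊗ H) ◁ ψ ≫
          (α_ (A ⊗ H) A H).inv ≫ twistAct ψ ▷ H ≫ r) ▷ H ≫ r =
        (α_ (A ⊗ H) A H).inv ▷ (A ⊗ H) ≫ (α_ ((A ⊗ H) ⊗ A) H (A ⊗ H)).hom ≫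
          twistAct ψ ▷ (H ⊗ (A ⊗ H)) ≫ (A ⊗ H) ◁ ((α_ H A H).inv ≫ ψ ▷ H ≫ (α_ A H H).hom) ≫
          (α_ (A ⊗ H) A (H ⊗ H)).inv ≫ twistAct ψ ▷ (H ⊗ H) ≫
            (α_ (A ⊗ H) H H).inv ≫ r ▷ H ≫ r := by
      monoidal
    rw [e, h1, e', ← whisker_exchange_assoc]
    monoidal
  have e2 : (A ⊗ H) ◁ twistMul ψ ≫ twistMul ψ =
      (A ⊗ H) ◁ ((α_ A H (A ⊗ H)).hom ≫ A ◁ ((α_ H A H).inv ≫ ψ ▷ H ≫ (α_ A H H).hom) ≫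
    (α_ A A (H ⊗ H)).inv ≫ μ[A] ▷ (H ⊗ H)) ≫ (α_ (A ⊗ H) A (H ⊗ H)).inv ≫
      ((A ⊗ H) ⊗ A) ◁ μ[H] ≫ twistAct ψ ▷ H ≫ r := by
    have e : (A ⊗ H) ◁ twistMul ψ = (A ⊗ H) ◁ ((α_ A H (A ⊗ H)).hom ≫
        A ◁ ((α_ H A H).inv ≫ ψ ▷ H ≫ (α_ A H H).hom) ≫ (α_ A A (H ⊗ H)).inv ≫
          μ[A] ▷ (H ⊗ H) ≫ A ◁ μ[H]) := by
      rw [twistMul, MonoidalCategory.tensorHom_def]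
    rw [e, h]
    monoidal
  rw [e1, e2, h2, h3, whisker_exchange_assoc]
  monoidal

/-- The algebra `A ⊗ H` with the multiplication defined by a distributive law. -/
abbrev twistMonObj : MonObj (A ⊗ H) where
  one := (λ_ (𝟙_ C)).inv ≫ (η[A] ⊗ₘ η[H])
  mul := twistMul ψ
  one_mul := by
    have e : ((λ_ (𝟙_ C)).inv ≫ (η[A] ⊗ₘ η[H])) ▷ (A ⊗ H) ≫ twistMul ψ =
        (λ_ (𝟙_ C)).inv ▷ (A ⊗ H) ≫ (α_ (𝟙_ C) (𝟙_ C) (A ⊗ H)).hom ≫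
          𝟙_ C ◁ ((α_ (𝟙_ C) A H).inv ≫ (η[H] ▷ A ≫ ψ) ▷ H ≫ (α_ A H H).hom) ≫
            η[A] ▷ (A ⊗ (H ⊗ H)) ≫ (α_ A A (H ⊗ H)).inv ≫ (μ[A] ⊗ₘ μ[H]) := by
      have e : (η[A] ⊗ₘ η[H]) = 𝟙_ C ◁ η[H] ≫ η[A] ▷ H := MonoidalCategory.tensorHom_def' _ _
      rw [twistMul, e]
      simp only [comp_whiskerRight _ _ (A ⊗ H), Category.assoc]
      rw [associator_naturality_left_assoc, ← whisker_exchange_assoc]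
      monoidal
    have e' : (λ_ (𝟙_ C)).inv ▷ (A ⊗ H) ≫ (α_ (𝟙_ C) (𝟙_ C) (A ⊗ H)).hom ≫
          𝟙_ C ◁ ((α_ (𝟙_ C) A H).inv ≫ ((λ_ A).hom ≫ (ρ_ A).inv ≫ A ◁ η[H]) ▷ H ≫
            (α_ A H H).hom) ≫
            η[A] ▷ (A ⊗ (H ⊗ H)) ≫ (α_ A A (H ⊗ H)).inv ≫ μ[A] ▷ (H ⊗ H) ≫ A ◁ μ[H] =
        (λ_ (𝟙_ C ⊗ (A ⊗ H))).inv ≫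
          𝟙_ C ◁ ((λ_ (A ⊗ H)).hom ≫ A ◁ ((λ_ H).inv ≫ η[H] ▷ H)) ≫
            (α_ (𝟙_ C) A (H ⊗ H)).inv ≫ (η[A] ▷ A ≫ μ[A]) ▷ (H ⊗ H) ≫ A ◁ μ[H] := by
      monoidal
    rw [e, IsDistributiveLaw.one_left, MonoidalCategory.tensorHom_def, e', MonObj.one_mul]
    have e2 : (λ_ (𝟙_ C ⊗ (A ⊗ H))).inv ≫
          𝟙_ C ◁ ((λ_ (A ⊗ H)).hom ≫ A ◁ ((λ_ H).inv ≫ η[H] ▷ H)) ≫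
            (α_ (𝟙_ C) A (H ⊗ H)).inv ≫ (λ_ A).hom ▷ (H ⊗ H) ≫ A ◁ μ[H] =
        (λ_ (A ⊗ H)).hom ≫ A ◁ (λ_ H).inv ≫ A ◁ (η[H] ▷ H ≫ μ[H]) := by
      monoidal
    rw [e2, MonObj.one_mul]
    monoidal
  mul_one := by
    have e : (A ⊗ H) ◁ ((λ_ (𝟙_ C)).inv ≫ (η[A] ⊗ₘ η[H])) ≫ twistMul ψ =
        (A ⊗ H) ◁ (λ_ (𝟙_ C)).inv ≫ (α_ (A ⊗ H) (𝟙_ C) (𝟙_ C)).inv ≫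
          ((A ⊗ H) ◁ η[A] ≫ twistAct ψ) ▷ 𝟙_ C ≫ (α_ A H (𝟙_ C)).hom ≫
            A ◁ (H ◁ η[H] ≫ μ[H]) := by
      rw [twistMul_eq, MonoidalCategory.tensorHom_def]
      simp only [MonoidalCategory.whiskerLeft_comp, Category.assoc]
      rw [associator_inv_naturality_right_assoc, whisker_exchange_assoc]
      monoidal
    rw [e, one_twistAct, MonObj.mul_one]
    monoidal
  mul_assoc := twistMul_assoc ψ

end DistributiveLaw

/-! ### The embeddings of A and H, and morphisms out of the twisted tensor product. -/

section TwistedTensor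

variable {C : Type u} [Category.{v} C] [MonoidalCategory C] {A H : C} [MonObj A] [MonObj H]

variable (A H) in
/-- The morphism `A ⟶ A ⊗ H`, `a ↦ a ⊗ 1`. -/
def twistInl : A ⟶ A ⊗ H := (ρ_ A).inv ≫ A ◁ η[H]

variable (A H) in
/-- The morphism `H ⟶ A ⊗ H`, `h ↦ 1 ⊗ h`. -/
def twistInr : H ⟶ A ⊗ H := (λ_ H).inv ≫ η[A] ▷ H

/-- Rearrangement of a product of four factors. -/
lemma tensorHom_mul_mul {E W X Y Z : C} [MonObj E] (f : W ⟶ E) (g : X ⟶ E) (r : Y ⟶ E)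
    (s : Z ⟶ E) :
    (α_ W X (Y ⊗ Z)).inv ≫ ((f ⊗ₘ g) ≫ μ[E] ⊗ₘ (r ⊗ₘ s) ≫ μ[E]) ≫ μ[E] =
      W ◁ ((α_ X Y Z).inv ≫ ((g ⊗ₘ r) ≫ μ[E]) ▷ Z ≫ E ◁ s ≫ μ[E]) ≫ f ▷ E ≫ μ[E] := by
  have e : (α_ E E (E ⊗ E)).inv ≫ (μ[E] ⊗ₘ μ[E]) ≫ μ[E] =
      E ◁ ((α_ E E E).inv ≫ μ[E] ▷ E ≫ μ[E]) ≫ μ[E] := by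
    rw [MonoidalCategory.tensorHom_def', Category.assoc, MonObj.mul_assoc,
      Iso.inv_hom_id_assoc]
    monoidal
  have e1 : (α_ X Y Z).inv ≫ ((g ⊗ₘ r) ≫ μ[E]) ▷ Z ≫ E ◁ s ≫ μ[E] =
      (g ⊗ₘ r ⊗ₘ s) ≫ (α_ E E E).inv ≫ μ[E] ▷ E ≫ μ[E] := by
    rw [associator_inv_naturality_assoc, comp_whiskerRight_assoc, ← whisker_exchange_assoc,
      MonoidalCategory.tensorHom_def (g ⊗ₘ r) s, Category.assoc]
  rw [← tensorHom_comp_tensorHom_assoc, ← associator_inv_naturality_assoc, e, e1,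
    whisker_exchange_assoc, MonoidalCategory.tensorHom_def f, Category.assoc,
    ← MonoidalCategory.whiskerLeft_comp_assoc]

section

variable (ψ : H ⊗ A ⟶ A ⊗ H)

lemma mul_twistInl : (A ⊗ H) ◁ twistInl A H ≫ twistMul ψ = twistAct ψ := by
  have e : (A ⊗ H) ◁ twistInl A H ≫ twistMul ψ = (ρ_ _).inv ≫ twistAct ψ ▷ 𝟙_ C ≫
      (α_ A H (𝟙_ C)).hom ≫ A ◁ (H ◁ η[H] ≫ μ[H]) := by
    rw [twistMul_eq, twistInl]
    simp only [MonoidalCategory.whiskerLeft_comp, Category.assoc]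
    rw [associator_inv_naturality_right_assoc, whisker_exchange_assoc]
    monoidal
  rw [e, MonObj.mul_one]
  monoidal

/-- The law is recovered from the product in the wrong order. With `twistInl_twistInr`, this
identifies the terms in the compatibility condition of `isMonHom_twistLift`. -/
lemma twistInr_twistInl : (twistInr A H ⊗ₘ twistInl A H) ≫ twistMul ψ = ψ := by
  rw [MonoidalCategory.tensorHom_def, Category.assoc, mul_twistInl]
  have e : twistInr A H ▷ A ≫ twistAct ψ = (λ_ H).inv ▷ A ≫ (α_ (𝟙_ C) H A).hom ≫
      η[A] ▷ (H ⊗ A) ≫ A ◁ ψ ≫ (α_ A A H).inv ≫ μ[A] ▷ H := by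
    rw [twistInr, twistAct]; monoidal
  have e' : (λ_ H).inv ▷ A ≫ (α_ (𝟙_ C) H A).hom ≫
      𝟙_ C ◁ ψ ≫ η[A] ▷ (A ⊗ H) ≫ (α_ A A H).inv ≫ μ[A] ▷ H =
      (λ_ (H ⊗ A)).inv ≫ 𝟙_ C ◁ ψ ≫ (α_ (𝟙_ C) A H).inv ≫ (η[A] ▷ A ≫ μ[A]) ▷ H := by
    monoidal
  rw [e, ← whisker_exchange_assoc, e', MonObj.one_mul]
  monoidal

end

variable (ψ : H ⊗ A ⟶ A ⊗ H) [IsDistributiveLaw ψ]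

lemma twistInl_mul : twistInl A H ▷ (A ⊗ H) ≫ twistMul ψ = (α_ A A H).inv ≫ μ[A] ▷ H := by
  have e : twistInl A H ▷ (A ⊗ H) ≫ twistMul ψ =
      (ρ_ A).inv ▷ (A ⊗ H) ≫ (α_ A (𝟙_ C) (A ⊗ H)).hom ≫
        A ◁ ((α_ (𝟙_ C) A H).inv ≫ (η[H] ▷ A ≫ ψ) ▷ H ≫ (α_ A H H).hom) ≫
    (α_ A A (H ⊗ H)).inv ≫ (μ[A] ⊗ₘ μ[H]) := by
    rw [twistMul, twistInl]
    monoidal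
  have e' : (ρ_ A).inv ▷ (A ⊗ H) ≫ (α_ A (𝟙_ C) (A ⊗ H)).hom ≫
        A ◁ ((α_ (𝟙_ C) A H).inv ≫ ((λ_ A).hom ≫ (ρ_ A).inv ≫ A ◁ η[H]) ▷ H ≫ (α_ A H H).hom) ≫
    (α_ A A (H ⊗ H)).inv ≫ (A ⊗ A) ◁ μ[H] ≫ μ[A] ▷ H =
      (α_ A A H).inv ≫ (A ⊗ A) ◁ ((λ_ H).inv ≫ η[H] ▷ H ≫ μ[H]) ≫ μ[A] ▷ H := by
    monoidal
  rw [e, IsDistributiveLaw.one_left, MonoidalCategory.tensorHom_def', e', MonObj.one_mul]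
  simp

lemma mul_twistInr : (A ⊗ H) ◁ twistInr A H ≫ twistMul ψ = (α_ A H H).hom ≫ A ◁ μ[H] := by
  have e : (A ⊗ H) ◁ twistInr A H ≫ twistMul ψ =
      (ρ_ (A ⊗ H)).inv ▷ H ≫ ((A ⊗ H) ◁ η[A] ≫ twistAct ψ) ▷ H ≫ (α_ A H H).hom ≫ A ◁ μ[H] := by
    rw [twistMul_eq, twistInr]
    monoidal
  rw [e, one_twistAct]
  simp

lemma twistInl_twistInr : (twistInl A H ⊗ₘ twistInr A H) ≫ twistMul ψ = 𝟙 (A ⊗ H) := by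
  rw [MonoidalCategory.tensorHom_def, Category.assoc, mul_twistInr]
  have e : twistInl A H ▷ H ≫ (α_ A H H).hom ≫ A ◁ μ[H] =
      (ρ_ A).inv ▷ H ≫ (α_ A (𝟙_ C) H).hom ≫ A ◁ (η[H] ▷ H ≫ μ[H]) := by
    rw [twistInl]; monoidal
  rw [e, MonObj.one_mul]
  monoidal

lemma isMonHom_twistInl :
    letI := twistMonObj ψ
    IsMonHom (twistInl A H) :=
  letI := twistMonObj ψ
  { one_hom := by
      change η[A] ≫ twistInl A H = (λ_ (𝟙_ C)).inv ≫ (η[A] ⊗ₘ η[H])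
      rw [twistInl, MonoidalCategory.tensorHom_def]
      monoidal
    mul_hom := by
      change μ[A] ≫ twistInl A H = (twistInl A H ⊗ₘ twistInl A H) ≫ twistMul ψ
      rw [MonoidalCategory.tensorHom_def', Category.assoc, twistInl_mul, twistInl,
        rightUnitor_inv_naturality_assoc, ← whisker_exchange]
      monoidal }

lemma isMonHom_twistInr :
    letI := twistMonObj ψ
    IsMonHom (twistInr A H) :=
  letI := twistMonObj ψ
  { one_hom := by
      change η[H] ≫ twistInr A H = (λ_ (𝟙_ C)).inv ≫ (η[A] ⊗ₘ η[H])
      rw [twistInr, MonoidalCategory.tensorHom_def']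
      monoidal
    mul_hom := by
      change μ[H] ≫ twistInr A H = (twistInr A H ⊗ₘ twistInr A H) ≫ twistMul ψ
      rw [MonoidalCategory.tensorHom_def, Category.assoc, mul_twistInr, twistInr,
        leftUnitor_inv_naturality_assoc, whisker_exchange]
      monoidal }

/-- Two morphisms of algebras that are compatible with the distributive law define a morphism from
the twisted tensor product. -/
lemma isMonHom_twistLift {E : C} [MonObj E] (p : A ⟶ E) (q : H ⟶ E) [IsMonHom p] [IsMonHom q]
    (h : ψ ≫ (p ⊗ₘ q) ≫ μ[E] = (q ⊗ₘ p) ≫ μ[E]) :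
    letI := twistMonObj ψ
    IsMonHom ((p ⊗ₘ q) ≫ μ[E]) :=
  letI := twistMonObj ψ
  { one_hom := by
      change ((λ_ (𝟙_ C)).inv ≫ (η[A] ⊗ₘ η[H])) ≫ (p ⊗ₘ q) ≫ μ[E] = η[E]
      rw [Category.assoc, tensorHom_comp_tensorHom_assoc, IsMonHom.one_hom, IsMonHom.one_hom]
      simp [MonoidalCategory.tensorHom_def']
    mul_hom := by
      change twistMul ψ ≫ (p ⊗ₘ q) ≫ μ[E] = ((p ⊗ₘ q) ≫ μ[E] ⊗ₘ (p ⊗ₘ q) ≫ μ[E]) ≫ μ[E]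
      rw [twistMul]
      simp only [Category.assoc]
      -- Both sides become fourfold products in E with the same outer factors; the two middle
      -- factors are compared by `h`.
      rw [tensorHom_comp_tensorHom_assoc, IsMonHom.mul_hom, IsMonHom.mul_hom, tensorHom_mul_mul,
        ← cancel_epi (α_ A H (A ⊗ H)).inv, Iso.inv_hom_id_assoc, tensorHom_mul_mul,
        ← MonoidalCategory.whiskerLeft_comp_assoc]
      simp only [Category.assoc, Iso.hom_inv_id_assoc]
      rw [← comp_whiskerRight_assoc, h] }

end TwistedTensor

/-! ### The braided tensor product as a twisted tensor product. -/

section BraidedTensor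

variable {C : Type u} [Category.{v} C] [MonoidalCategory C] [BraidedCategory C]

instance isDistributiveLaw_braiding (B H : C) [MonObj B] [MonObj H] :
    IsDistributiveLaw (β_ H B).hom where
  one_left := by
    rw [BraidedCategory.braiding_naturality_left]; simp
  one_right := by
    rw [BraidedCategory.braiding_naturality_right]; simp
  mul_left := by
    rw [BraidedCategory.braiding_naturality_left, BraidedCategory.braiding_tensor_left_hom]
    simp
  mul_right := by
    rw [BraidedCategory.braiding_naturality_right, BraidedCategory.braiding_tensor_right_hom]
    simp

lemma twistMul_braiding (B H : C) [MonObj B] [MonObj H] :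
    twistMul (β_ H B).hom = μ[B ⊗ H] := by
  change _ = tensorμ B H B H ≫ (μ[B] ⊗ₘ μ[H])
  simp [twistMul, tensorμ]

instance isMonHom_inl (B H : C) [MonObj B] [MonObj H] : IsMonHom (twistInl B H) := by
  have : IsMonHom η[H] := { one_hom := by simp, mul_hom := by simp [unitors_equal] }
  rw [twistInl]
  infer_instance

variable {A B H : C} [MonObj B] [BimonObj H]

instance isMonHom_comul : IsMonHom Δ[H] where
  one_hom := BimonObj.one_comul H
  mul_hom := BimonObj.mul_comul H

/-- This lemma and the next one compute the products of p(a) ⊗ 1 and q(h₁) ⊗ h₂ in B ⊗ H in both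
orders, as needed to see that the coaction is multiplicative. -/
lemma inl_comul_mul (p : A ⟶ B) (q : H ⟶ B) :
    (p ≫ twistInl B H ⊗ₘ Δ[H] ≫ q ▷ H) ≫ μ[B ⊗ H] =
      A ◁ Δ[H] ≫ (α_ A H H).inv ≫ ((p ⊗ₘ q) ≫ μ[B]) ▷ H := by
  rw [← twistMul_braiding, MonoidalCategory.tensorHom_def', comp_whiskerRight, Category.assoc,
    Category.assoc, twistInl_mul, ← MonoidalCategory.tensorHom_def'_assoc]
  simp [MonoidalCategory.tensorHom_def']

lemma comul_inl_mul (p : A ⟶ B) (q : H ⟶ B) :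
    (Δ[H] ≫ q ▷ H ⊗ₘ p ≫ twistInl B H) ≫ μ[B ⊗ H] =
      Δ[H] ▷ A ≫ (α_ H H A).hom ≫ H ◁ (β_ H A).hom ≫ (α_ H A H).inv ≫
        ((q ⊗ₘ p) ≫ μ[B]) ▷ H := by
  rw [← twistMul_braiding, MonoidalCategory.tensorHom_def, MonoidalCategory.whiskerLeft_comp,
    Category.assoc, Category.assoc, mul_twistInl, twistAct]
  have e : (Δ[H] ≫ q ▷ H) ▷ A ≫ (B ⊗ H) ◁ p ≫ (α_ B H B).hom ≫ B ◁ (β_ H B).hom ≫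
      (α_ B B H).inv ≫ μ[B] ▷ H = Δ[H] ▷ A ≫ (q ▷ H) ▷ A ≫ (α_ B H A).hom ≫
        B ◁ (H ◁ p ≫ (β_ H B).hom) ≫ (α_ B B H).inv ≫ μ[B] ▷ H := by
    monoidal
  rw [e, BraidedCategory.braiding_naturality_right, associator_naturality_left_assoc,
    MonoidalCategory.whiskerLeft_comp_assoc, ← whisker_exchange_assoc,
    MonoidalCategory.tensorHom_def]
  monoidal

end BraidedTensor

/-! ### The smash product as a comodule algebra. -/

section Smash

variable {C : Type u} [Category.{v} C] [MonoidalCategory C] [BraidedCategory C] {H : C}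

section

variable [BimonObj H]

lemma entwine_natural {M N : Mod C H} (f : M ⟶ N) :
    H ◁ f.hom ≫ entwine H N.X = entwine H M.X ≫ f.hom ▷ H := by
  simp only [entwine, Category.assoc]
  rw [← comp_whiskerRight, act_hom, whisker_exchange_assoc, associator_naturality_right_assoc,
    ← MonoidalCategory.whiskerLeft_comp_assoc, BraidedCategory.braiding_naturality_right]
  monoidal

attribute [local instance] ModObj.regular in
-- The entwining is the diagonal action on M ⊗ H evaluated at 1 ∈ H, so this is the associativity of
-- diagonal actions with the regular module as last factor.
lemma entwine_tensor (M N : C) [ModObj H M] [ModObj H N] :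
    entwine H (M ⊗ N) = (α_ H M N).inv ≫ entwine H M ▷ N ≫ (α_ M H N).hom ≫
      M ◁ entwine H N ≫ (α_ M N H).inv := by
  have h := diagAct_assoc (H := H) ⟨M⟩ ⟨N⟩ ⟨H⟩
  dsimp only at h
  rw [← cancel_mono (α_ M N H).hom, entwine_eq (M ⊗ N), Category.assoc, h, diagAct_eq,
    act_tensor, entwine_eq N]
  have e : H ◁ ((ρ_ (M ⊗ N)).inv ≫ (M ⊗ N) ◁ η[H]) ≫ H ◁ (α_ M N H).hom ≫ (α_ H M (N ⊗ H)).inv =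
      (α_ H M N).inv ≫ (H ⊗ M) ◁ ((ρ_ N).inv ≫ N ◁ η[H]) := by
    monoidal
  rw [reassoc_of% e, whisker_exchange_assoc]
  monoidal

lemma entwine_unit : entwine H (𝟙_ C) = (ρ_ H).hom ≫ (λ_ H).inv := by
  have e : entwine H (𝟙_ C) = (Δ[H] ≫ ε[H] ▷ H) ▷ 𝟙_ C ≫ (ρ_ _).hom ≫ (λ_ _).hom ≫ (λ_ _).inv := by
    rw [entwine, act_unit, unitAct, braiding_tensorUnit_right]
    monoidal
  rw [e, ComonObj.counit_comul]
  monoidal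

/-- Coassociativity: both sides are h₁ m ⊗ h₂ ⊗ h₃. This is the compatibility that makes the
coaction of the smash product multiplicative. -/
lemma entwine_comul (M : C) [ModObj H M] :
    entwine H M ≫ M ◁ Δ[H] ≫ (α_ M H H).inv =
      Δ[H] ▷ M ≫ (α_ H H M).hom ≫ H ◁ (β_ H M).hom ≫ (α_ H M H).inv ≫ entwine H M ▷ H := by
  have e1 : entwine H M ≫ M ◁ Δ[H] ≫ (α_ M H H).inv =
      (Δ[H] ≫ H ◁ Δ[H]) ▷ M ≫ (α_ H (H ⊗ H) M).hom ≫ H ◁ (β_ (H ⊗ H) M).hom ≫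
        (α_ H M (H ⊗ H)).inv ≫ act H M ▷ (H ⊗ H) ≫ (α_ M H H).inv := by
    simp only [entwine, Category.assoc]
    rw [← whisker_exchange_assoc, ← associator_inv_naturality_right_assoc,
      ← MonoidalCategory.whiskerLeft_comp_assoc, ← BraidedCategory.braiding_naturality_left]
    monoidal
  have e2 : Δ[H] ▷ M ≫ (α_ H H M).hom ≫ H ◁ (β_ H M).hom ≫ (α_ H M H).inv ≫
      entwine H M ▷ H = (Δ[H] ≫ Δ[H] ▷ H) ▷ M ≫ (α_ (H ⊗ H) H M).hom ≫
        (H ⊗ H) ◁ (β_ H M).hom ≫ (α_ (H ⊗ H) M H).inv ≫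
          ((α_ H H M).hom ≫ H ◁ (β_ H M).hom ≫ (α_ H M H).inv ≫ act H M ▷ H) ▷ H := by
    have e : Δ[H] ▷ M ≫ (α_ H H M).hom ≫ H ◁ (β_ H M).hom ≫ (α_ H M H).inv ≫
      entwine H M ▷ H = Δ[H] ▷ M ≫ (α_ H H M).hom ≫ H ◁ (β_ H M).hom ≫ Δ[H] ▷ (M ⊗ H) ≫
        (α_ (H ⊗ H) M H).inv ≫
          ((α_ H H M).hom ≫ H ◁ (β_ H M).hom ≫ (α_ H M H).inv ≫ act H M ▷ H) ▷ H := by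
      rw [entwine]; monoidal
    rw [e, whisker_exchange_assoc]
    monoidal
  rw [e1, e2, ComonObj.comul_assoc, BraidedCategory.braiding_tensor_left_hom]
  monoidal

variable (A : Mod C H) [MonObj A]

/-- The axioms in H are the module axioms of A. Those in A say that its unit and multiplication are
H-linear, by naturality of the entwining and its values on I and A ⊗ A. -/
instance isDistributiveLaw_entwine : IsDistributiveLaw (entwine H A.X) where
  one_left := one_entwine A.X
  one_right := by
    have := entwine_natural (η[A] : 𝟙_ (Mod C H) ⟶ A)
    refine this.trans ?_
    change entwine H (𝟙_ C) ≫ _ = _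
    rw [entwine_unit, Category.assoc]
    rfl
  mul_left := mul_entwine A.X
  mul_right := by
    have := entwine_natural (μ[A] : A ⊗ A ⟶ A)
    refine this.trans ?_
    change entwine H (A.X ⊗ A.X) ≫ _ = _
    rw [entwine_tensor]
    simp only [Category.assoc]
    rfl

/-- The coaction is the product of the algebra morphisms a ↦ (a # 1) ⊗ 1 and h ↦ (1 # h₁) ⊗ h₂, so
`isMonHom_twistLift` applies. -/
lemma isMonHom_smashCoact :
    letI : MonObj (A.X ⊗ H) := twistMonObj (entwine H A.X)
    IsMonHom (smashCoact A) := by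
  let : MonObj (A.X ⊗ H) := twistMonObj (entwine H A.X)
  have := isMonHom_twistInl (entwine H A.X)
  have := isMonHom_twistInr (entwine H A.X)
  have e1 := inl_comul_mul (twistInl A.X H) (twistInr A.X H)
  have e2 := comul_inl_mul (twistInl A.X H) (twistInr A.X H)
  have h1 : (twistInl A.X H ⊗ₘ twistInr A.X H) ≫ μ[A.X ⊗ H] = 𝟙 _ :=
    twistInl_twistInr (entwine H A.X)
  have h2 : (twistInr A.X H ⊗ₘ twistInl A.X H) ≫ μ[A.X ⊗ H] = entwine H A.X :=
    twistInr_twistInl (entwine H A.X)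
  rw [h1, id_whiskerRight, Category.comp_id] at e1
  rw [h2] at e2
  rw [smashCoact, ← e1]
  apply isMonHom_twistLift
  rw [e1, e2, entwine_comul]

end

end Smash

/-! ### Base change of morphisms between free modules. -/

section Extension

variable {C : Type u} [Category.{v} C] [MonoidalCategory C]

lemma tensorHom_mul_assoc {B X Y Z : C} [MonObj B] (f : X ⟶ B) (g : Y ⟶ B) (r : Z ⟶ B) :
    (α_ X Y Z).inv ≫ ((f ⊗ₘ g) ≫ μ[B] ⊗ₘ r) ≫ μ[B] = (f ⊗ₘ (g ⊗ₘ r) ≫ μ[B]) ≫ μ[B] := by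
  have e1 : ((f ⊗ₘ g) ≫ μ[B] ⊗ₘ r) = ((f ⊗ₘ g) ⊗ₘ r) ≫ μ[B] ▷ B := by
    rw [← tensorHom_id, tensorHom_comp_tensorHom, Category.comp_id]
  have e2 : (f ⊗ₘ (g ⊗ₘ r) ≫ μ[B]) = (f ⊗ₘ (g ⊗ₘ r)) ≫ B ◁ μ[B] := by
    rw [← id_tensorHom, tensorHom_comp_tensorHom, Category.comp_id]
  rw [e1, e2, Category.assoc, ← associator_inv_naturality_assoc, MonObj.mul_assoc,
    Iso.inv_hom_id_assoc, Category.assoc]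

variable {A B : C} [MonObj A] (s : B ⊗ A ⟶ B)

/-- The morphism `b ⊗ x ↦ b a ⊗ y` for `k(x) = a ⊗ y`. -/
def extend {X Y : C} (k : X ⟶ A ⊗ Y) : B ⊗ X ⟶ B ⊗ Y :=
  B ◁ k ≫ (α_ B A Y).inv ≫ s ▷ Y

lemma twistInr_extend {X Y : C} (k : X ⟶ A ⊗ Y) :
    ((λ_ X).inv ≫ η[A] ▷ X) ≫ extend μ[A] k = k := by
  have e : ((λ_ X).inv ≫ η[A] ▷ X) ≫ A ◁ k ≫ (α_ A A Y).inv ≫ μ[A] ▷ Y =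
      (λ_ X).inv ≫ 𝟙_ C ◁ k ≫ (α_ (𝟙_ C) A Y).inv ≫ (η[A] ▷ A ≫ μ[A]) ▷ Y := by
    rw [Category.assoc, ← whisker_exchange_assoc]
    monoidal
  rw [extend, e, MonObj.one_mul]
  monoidal

/-- A morphism k : X ⟶ A ⊗ Y is a Kleisli morphism for the monad A ⊗ -, and a right A-module B turns
Kleisli composition into composition. -/
lemma extend_comp (hs : B ◁ μ[A] ≫ s = (α_ B A A).inv ≫ s ▷ A ≫ s) {X Y Z : C} (k : X ⟶ A ⊗ Y)
    (n : Y ⟶ A ⊗ Z) : extend s k ≫ extend s n = extend s (k ≫ extend μ[A] n) := by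
  have e : extend s (k ≫ extend μ[A] n) = B ◁ k ≫ B ◁ A ◁ n ≫ B ◁ (α_ A A Z).inv ≫
      (α_ B (A ⊗ A) Z).inv ≫ (B ◁ μ[A] ≫ s) ▷ Z := by
    simp only [extend]; monoidal
  rw [e, hs]
  simp only [extend, Category.assoc]
  rw [← whisker_exchange_assoc]
  monoidal

lemma extend_one (hs : B ◁ η[A] ≫ s = (ρ_ B).hom) (X : C) :
    extend s ((λ_ X).inv ≫ η[A] ▷ X) = 𝟙 (B ⊗ X) := by
  have e : extend s ((λ_ X).inv ≫ η[A] ▷ X) = B ◁ (λ_ X).inv ≫ (α_ B (𝟙_ C) X).inv ≫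
      (B ◁ η[A] ≫ s) ▷ X := by
    rw [extend]; monoidal
  rw [e, hs]
  monoidal

/-- If `k` and `n` are inverse to each other, then so are the morphisms that they define on `B`. -/
lemma isIso_extend (hs : B ◁ μ[A] ≫ s = (α_ B A A).inv ≫ s ▷ A ≫ s)
    (hs' : B ◁ η[A] ≫ s = (ρ_ B).hom) {X Y : C} (k : X ⟶ A ⊗ Y) (n : Y ⟶ A ⊗ X)
    (h : k ≫ extend μ[A] n = (λ_ X).inv ≫ η[A] ▷ X)
    (h' : n ≫ extend μ[A] k = (λ_ Y).inv ≫ η[A] ▷ Y) : IsIso (extend s k) :=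
  ⟨extend s n, by rw [extend_comp s hs, h, extend_one s hs'],
    by rw [extend_comp s hs, h', extend_one s hs']⟩

/-- Base change from A to B: the inverse over A again comes from a Kleisli morphism, which then
supplies an inverse over B. -/
lemma isIso_extend_of_isIso (hs : B ◁ μ[A] ≫ s = (α_ B A A).inv ≫ s ▷ A ≫ s)
    (hs' : B ◁ η[A] ≫ s = (ρ_ B).hom) {X Y : C} (k : X ⟶ A ⊗ Y) [IsIso (extend μ[A] k)] :
    IsIso (extend s k) := by
  have h : A ◁ μ[A] ≫ μ[A] = (α_ A A A).inv ≫ μ[A] ▷ A ≫ μ[A] := by simp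
  -- The inverse restricted to 1 ⊗ Y.
  let n : Y ⟶ A ⊗ X := ((λ_ Y).inv ≫ η[A] ▷ Y) ≫ inv (extend μ[A] k)
  have hn : n ≫ extend μ[A] k = (λ_ Y).inv ≫ η[A] ▷ Y := by simp [n]
  refine isIso_extend s hs hs' k n ?_ hn
  have e : extend μ[A] n = inv (extend μ[A] k) := by
    rw [← cancel_mono (extend μ[A] k), extend_comp _ h, hn, extend_one _ (MonObj.mul_one A),
      IsIso.inv_hom_id]
  rw [e, IsIso.comp_inv_eq, twistInr_extend]

variable {B : C} [MonObj B]

lemma mul_restrict (i : A ⟶ B) [IsMonHom i] :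
    B ◁ μ[A] ≫ B ◁ i ≫ μ[B] = (α_ B A A).inv ≫ (B ◁ i ≫ μ[B]) ▷ A ≫ B ◁ i ≫ μ[B] := by
  rw [← MonoidalCategory.whiskerLeft_comp_assoc, IsMonHom.mul_hom, comp_whiskerRight_assoc,
    ← whisker_exchange_assoc, MonObj.mul_assoc, MonoidalCategory.tensorHom_def]
  monoidal

lemma one_restrict (i : A ⟶ B) [IsMonHom i] : B ◁ η[A] ≫ B ◁ i ≫ μ[B] = (ρ_ B).hom := by
  rw [← MonoidalCategory.whiskerLeft_comp_assoc, IsMonHom.one_hom, MonObj.mul_one]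

end Extension

/-! ### The canonical morphism becomes invertible after tensoring with A. -/

section Hopf

variable {C : Type u} [Category.{v} C] [MonoidalCategory C] [BraidedCategory C] {H B : C}
  [HopfObj H] [MonObj B]

/-- The morphism `b ⊗ h ↦ b h₁ ⊗ h₂` is an isomorphism. -/
lemma isIso_extend_comul (q : H ⟶ B) [IsMonHom q] : IsIso (extend (B ◁ q ≫ μ[B]) Δ[H]) := by
  -- The inverse comes from h ↦ S(h₁) ⊗ h₂.
  refine isIso_extend _ (mul_restrict q) (one_restrict q) Δ[H] (Δ[H] ≫ HopfObj.antipode ▷ H) ?_ ?_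
  · have e : Δ[H] ≫ extend μ[H] (Δ[H] ≫ HopfObj.antipode ▷ H) =
        (Δ[H] ≫ H ◁ Δ[H]) ≫ (α_ H H H).inv ≫ (H ◁ HopfObj.antipode ≫ μ[H]) ▷ H := by
      rw [extend]; monoidal
    have e' : (Δ[H] ≫ Δ[H] ▷ H ≫ (α_ H H H).hom) ≫ (α_ H H H).inv ≫
        (H ◁ HopfObj.antipode ≫ μ[H]) ▷ H =
        Δ[H] ≫ (Δ[H] ≫ H ◁ HopfObj.antipode ≫ μ[H]) ▷ H := by
      monoidal
    rw [e, ComonObj.comul_assoc, e', HopfObj.antipode_right, comp_whiskerRight,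
      ComonObj.counit_comul_assoc]
  · have e : (Δ[H] ≫ HopfObj.antipode ▷ H) ≫ extend μ[H] Δ[H] =
        Δ[H] ≫ HopfObj.antipode ▷ H ≫ H ◁ Δ[H] ≫ (α_ H H H).inv ≫ μ[H] ▷ H := by
      rw [extend]; monoidal
    have e' : (Δ[H] ≫ Δ[H] ▷ H ≫ (α_ H H H).hom) ≫ (α_ H H H).inv ≫
        (HopfObj.antipode ▷ H ≫ μ[H]) ▷ H =
        Δ[H] ≫ (Δ[H] ≫ HopfObj.antipode ▷ H ≫ μ[H]) ▷ H := by
      monoidal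
    have e2 : Δ[H] ≫ H ◁ Δ[H] ≫ HopfObj.antipode ▷ (H ⊗ H) ≫ (α_ H H H).inv ≫ μ[H] ▷ H =
      (Δ[H] ≫ H ◁ Δ[H]) ≫ (α_ H H H).inv ≫ (HopfObj.antipode ▷ H ≫ μ[H]) ▷ H := by
      monoidal
    rw [e, ← whisker_exchange_assoc, e2, ComonObj.comul_assoc, e', HopfObj.antipode_left,
      comp_whiskerRight, ComonObj.counit_comul_assoc]

/-- For a factorization `B ≅ A ⊗ H`, the morphism `b ⊗ t ↦ b t₀ ⊗ t₁` is an isomorphism if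
`A ⊗ T ⟶ B` is one. -/
lemma isIso_mul_coact {A T : C} [MonObj A] (i : A ⟶ B) (q : H ⟶ B) [IsMonHom i] [IsMonHom q]
    [IsIso ((i ⊗ₘ q) ≫ μ[B])] (ρ : B ⟶ B ⊗ H)
    (hρ : ((i ⊗ₘ q) ≫ μ[B]) ≫ ρ = A ◁ Δ[H] ≫ (α_ A H H).inv ≫ ((i ⊗ₘ q) ≫ μ[B]) ▷ H)
    (j : T ⟶ B) [IsIso (A ◁ j ≫ i ▷ B ≫ μ[B])] :
    IsIso (B ◁ (j ≫ ρ) ≫ (α_ B B H).inv ≫ μ[B] ▷ H) := by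
  -- The coordinates of T in A ⊗ H. By `h1`, the isomorphism A ⊗ T ⟶ B read in A ⊗ H is the
  -- extension of k.
  obtain ⟨k, hk⟩ : ∃ k : T ⟶ A ⊗ H, k ≫ (i ⊗ₘ q) ≫ μ[B] = j :=
    ⟨j ≫ inv ((i ⊗ₘ q) ≫ μ[B]), by simp⟩
  have h1 : extend μ[A] k ≫ (i ⊗ₘ q) ≫ μ[B] = A ◁ j ≫ i ▷ B ≫ μ[B] := by
    have e : μ[A] ▷ H ≫ (i ⊗ₘ q) = ((i ⊗ₘ i) ≫ μ[B] ⊗ₘ q) := by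
      rw [← tensorHom_id, tensorHom_comp_tensorHom, Category.id_comp, IsMonHom.mul_hom]
    rw [extend, ← hk, Category.assoc, Category.assoc, reassoc_of% e, tensorHom_mul_assoc,
      MonoidalCategory.whiskerLeft_comp, Category.assoc, MonoidalCategory.tensorHom_def' i,
      Category.assoc]
  have : IsIso (extend μ[A] k) := by
    have : IsIso (extend μ[A] k ≫ (i ⊗ₘ q) ≫ μ[B]) := by rw [h1]; infer_instance
    exact IsIso.of_isIso_comp_right _ ((i ⊗ₘ q) ≫ μ[B])
  have := isIso_extend_of_isIso _ (mul_restrict i) (one_restrict i) k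
  have := isIso_extend_comul q
  -- If k(t) = a ⊗ h, then b t₀ ⊗ t₁ = b i(a) q(h₁) ⊗ h₂: first extend k, then the comultiplication.
  have h2 : B ◁ (j ≫ ρ) ≫ (α_ B B H).inv ≫ μ[B] ▷ H =
      extend (B ◁ i ≫ μ[B]) k ≫ extend (B ◁ q ≫ μ[B]) Δ[H] := by
    have h3 : B ◁ ((i ⊗ₘ q) ≫ μ[B]) ≫ μ[B] =
        (α_ B A H).inv ≫ (B ◁ i ≫ μ[B]) ▷ H ≫ B ◁ q ≫ μ[B] := by
      rw [← id_tensorHom, ← tensorHom_mul_assoc, id_tensorHom,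
        MonoidalCategory.tensorHom_def _ q, Category.assoc]
    have h4 : B ◁ (k ≫ A ◁ Δ[H] ≫ (α_ A H H).inv ≫ ((i ⊗ₘ q) ≫ μ[B]) ▷ H) ≫
        (α_ B B H).inv ≫ μ[B] ▷ H = B ◁ k ≫ B ◁ A ◁ Δ[H] ≫ B ◁ (α_ A H H).inv ≫
          (α_ B (A ⊗ H) H).inv ≫ (B ◁ ((i ⊗ₘ q) ≫ μ[B]) ≫ μ[B]) ▷ H := by
      simp only [MonoidalCategory.whiskerLeft_comp, comp_whiskerRight, Category.assoc,
        associator_inv_naturality_middle_assoc]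
    have h5 := whisker_exchange (B ◁ i ≫ μ[B]) Δ[H]
    rw [← hk, Category.assoc, hρ, h4, h3]
    simp only [extend, Category.assoc]
    rw [← reassoc_of% h5]
    monoidal
  rw [h2]
  infer_instance

/-- The canonical morphism of a comodule subalgebra `T` of `B ≅ A ⊗ H` is an isomorphism after
tensoring with `A`, if `A ⊗ T ⟶ B` is an isomorphism. -/
lemma isIso_whiskerLeft_can {A T : C} [MonObj A] [MonObj T] (i : A ⟶ B) (q : H ⟶ B) [IsMonHom i]
    [IsMonHom q] [IsIso ((i ⊗ₘ q) ≫ μ[B])] (ρ : B ⟶ B ⊗ H)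
    (hρ : ((i ⊗ₘ q) ≫ μ[B]) ≫ ρ = A ◁ Δ[H] ≫ (α_ A H H).inv ≫ ((i ⊗ₘ q) ≫ μ[B]) ▷ H)
    (j : T ⟶ B) [IsMonHom j] [IsIso (A ◁ j ≫ i ▷ B ≫ μ[B])] (ρ' : T ⟶ T ⊗ H)
    (hj : ρ' ≫ j ▷ H = j ≫ ρ) : IsIso (A ◁ can H T ρ') := by
  have := isIso_mul_coact i q ρ hρ j
  -- The isomorphism A ⊗ T ≅ B carries A ⊗ can to b ⊗ t ↦ b t₀ ⊗ t₁, because multiplication in B is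
  -- associative and j is multiplicative and colinear.
  have e : (A ◁ j ≫ i ▷ B ≫ μ[B]) ▷ T ≫ B ◁ (j ≫ ρ) ≫ (α_ B B H).inv ≫ μ[B] ▷ H =
      (α_ A T T).hom ≫ A ◁ can H T ρ' ≫ (α_ A T H).inv ≫ (A ◁ j ≫ i ▷ B ≫ μ[B]) ▷ H := by
    have hm : (A ◁ j ≫ i ▷ B ≫ μ[B]) = (i ⊗ₘ j) ≫ μ[B] := by
      rw [MonoidalCategory.tensorHom_def', Category.assoc]
    have h1 : ((i ⊗ₘ j) ≫ μ[B]) ▷ T ≫ B ◁ j ≫ μ[B] =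
        (α_ A T T).hom ≫ A ◁ μ[T] ≫ (i ⊗ₘ j) ≫ μ[B] := by
      have : A ◁ μ[T] ≫ (i ⊗ₘ j) = (i ⊗ₘ (j ⊗ₘ j) ≫ μ[B]) := by
        rw [← id_tensorHom, tensorHom_comp_tensorHom, Category.id_comp, IsMonHom.mul_hom]
      rw [reassoc_of% this, ← tensorHom_mul_assoc, Iso.hom_inv_id_assoc,
        MonoidalCategory.tensorHom_def ((i ⊗ₘ j) ≫ μ[B]) j, Category.assoc]
    rw [hm]
    generalize (i ⊗ₘ j) ≫ μ[B] = m at h1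
    have h2 : m ▷ T ≫ B ◁ (ρ' ≫ j ▷ H) ≫ (α_ B B H).inv ≫ μ[B] ▷ H =
        m ▷ T ≫ B ◁ ρ' ≫ (α_ B T H).inv ≫ (B ◁ j ≫ μ[B]) ▷ H := by
      monoidal
    have h3 : (A ⊗ T) ◁ ρ' ≫ m ▷ (T ⊗ H) ≫ (α_ B T H).inv ≫ (B ◁ j ≫ μ[B]) ▷ H =
        (A ⊗ T) ◁ ρ' ≫ (α_ (A ⊗ T) T H).inv ≫ (m ▷ T ≫ B ◁ j ≫ μ[B]) ▷ H := by
      monoidal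
    rw [← hj, h2, ← whisker_exchange_assoc, h3, h1, can]
    monoidal
  have e' : A ◁ can H T ρ' = (α_ A T T).inv ≫ ((A ◁ j ≫ i ▷ B ≫ μ[B]) ▷ T ≫
      B ◁ (j ≫ ρ) ≫ (α_ B B H).inv ≫ μ[B] ▷ H) ≫ inv ((A ◁ j ≫ i ▷ B ≫ μ[B]) ▷ H) ≫
        (α_ A T H).hom := by
    rw [e]
    simp only [Category.assoc, IsIso.hom_inv_id_assoc, Iso.inv_hom_id_assoc, Iso.inv_hom_id,
      Category.comp_id]
  rw [e']
  infer_instance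

end Hopf

/-! ### Linearity of the braiding makes H transparent. -/

section Transparent

variable {C : Type u} [Category.{v} C] [MonoidalCategory C] [BraidedCategory C] {H : C}
  [BimonObj H]

variable (H) in
/-- The trivial `H`-action on an object, given by the counit of `H`. -/
abbrev trivModObj (X : C) : ModObj H X where
  smul := ε[H] ▷ X ≫ (λ_ X).hom
  one_smul := by
    change η[H] ▷ X ≫ ε[H] ▷ X ≫ (λ_ X).hom = (λ_ X).hom
    rw [← comp_whiskerRight_assoc, BimonObj.one_counit]; simp
  mul_smul := by
    change μ[H] ▷ X ≫ ε[H] ▷ X ≫ (λ_ X).hom =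
      (α_ H H X).hom ≫ H ◁ (ε[H] ▷ X ≫ (λ_ X).hom) ≫ ε[H] ▷ X ≫ (λ_ X).hom
    have h : μ[H] ≫ ε[H] = (ε[H] ⊗ₘ ε[H]) ≫ (λ_ (𝟙_ C)).hom := by
      rw [BimonObj.mul_counit]; rfl
    rw [← comp_whiskerRight_assoc, h, MonoidalCategory.tensorHom_def']
    simp only [MonoidalCategory.whiskerLeft_comp, comp_whiskerRight, Category.assoc]
    monoidal

variable (H) in
/-- An object with the trivial `H`-action. -/
def trivMod (X : C) : Mod C H := letI := trivModObj H X; ⟨X⟩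

lemma entwine_counit (M : C) [ModObj H M] :
    entwine H M ≫ M ◁ ε[H] = act H M ≫ (ρ_ M).inv := by
  have e : entwine H M ≫ M ◁ ε[H] = (Δ[H] ≫ H ◁ ε[H]) ▷ M ≫ (α_ H (𝟙_ C) M).hom ≫
      H ◁ (β_ (𝟙_ C) M).hom ≫ (α_ H M (𝟙_ C)).inv ≫ act H M ▷ 𝟙_ C := by
    simp only [entwine, Category.assoc]
    rw [← whisker_exchange, ← associator_inv_naturality_right_assoc,
      ← MonoidalCategory.whiskerLeft_comp_assoc, ← BraidedCategory.braiding_naturality_left]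
    monoidal
  rw [e, ComonObj.comul_counit, braiding_tensorUnit_left]
  monoidal

lemma entwine_of_trivial (X : C) [ModObj H X] (h : act H X = ε[H] ▷ X ≫ (λ_ X).hom) :
    entwine H X = (β_ H X).hom := by
  have e : entwine H X = (Δ[H] ≫ ε[H] ▷ H) ▷ X ≫ (α_ (𝟙_ C) H X).hom ≫
      𝟙_ C ◁ (β_ H X).hom ≫ (λ_ _).hom := by
    rw [entwine, h]
    have : H ◁ (β_ H X).hom ≫ ε[H] ▷ (X ⊗ H) = ε[H] ▷ (H ⊗ X) ≫ 𝟙_ C ◁ (β_ H X).hom :=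
      whisker_exchange _ _
    have e' : Δ[H] ▷ X ≫ (α_ H H X).hom ≫ H ◁ (β_ H X).hom ≫ (α_ H X H).inv ≫
        (ε[H] ▷ X ≫ (λ_ X).hom) ▷ H = Δ[H] ▷ X ≫ (α_ H H X).hom ≫ H ◁ (β_ H X).hom ≫
          ε[H] ▷ (X ⊗ H) ≫ (λ_ _).hom := by
      monoidal
    rw [e', reassoc_of% this]
    monoidal
  rw [e, ComonObj.counit_comul]
  simp

attribute [local instance] ModObj.regular in
/-- If the braiding is `H`-linear, then the braidings of `H` with any object are inverse to each
other. -/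
lemma braiding_braiding_eq_id [BraidingLinear H] (X : C) :
    (β_ H X).hom ≫ (β_ X H).hom = 𝟙 (H ⊗ X) := by
  let := trivModObj H X
  have h : diagAct H X H ≫ (β_ X H).hom = H ◁ (β_ X H).hom ≫ diagAct H H X :=
    BraidingLinear.linear (trivMod H X) (Mod.regular H)
  have h1 : entwine H X = (β_ H X).hom := entwine_of_trivial X rfl
  have h2 : diagAct H H X = (α_ H H X).inv ≫ μ[H] ▷ X := by
    have e : diagAct H H X = (α_ H H X).inv ≫ (entwine H H ≫ H ◁ ε[H]) ▷ X ≫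
        (α_ _ _ _).hom ≫ H ◁ (λ_ X).hom := by
      rw [diagAct_eq]
      change _ ≫ _ ≫ _ ≫ H ◁ (ε[H] ▷ X ≫ (λ_ X).hom) = _
      monoidal
    rw [e, entwine_counit, act_regular]
    monoidal
  have h3 : ((ρ_ X).inv ≫ X ◁ η[H]) ≫ (β_ X H).hom = (λ_ X).inv ≫ η[H] ▷ X := by
    rw [Category.assoc, BraidedCategory.braiding_naturality_right]
    simp
  -- Linearity is evaluated at h ⊗ (x ⊗ 1). Acting first and braiding afterwards gives the double
  -- braiding; braiding first gives h acting on 1 ⊗ x, which is h ⊗ x.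
  rw [← h1, entwine_eq, Category.assoc, h, ← MonoidalCategory.whiskerLeft_comp_assoc, h3, h2]
  have e : H ◁ ((λ_ X).inv ≫ η[H] ▷ X) ≫ (α_ H H X).inv ≫ μ[H] ▷ X =
      H ◁ (λ_ X).inv ≫ (α_ H (𝟙_ C) X).inv ≫ (H ◁ η[H] ≫ μ[H]) ▷ X := by monoidal
  rw [e, MonObj.mul_one]
  monoidal

end Transparent

/-! ### Restriction of the coaction to the centralizer. -/

section Coaction

variable {C : Type u} [Category.{v} C] [MonoidalCategory C]

lemma Flat.tensor {X Y : C} (hX : Flat X) (hY : Flat Y) : Flat (X ⊗ Y) :=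
  have : PreservesLimitsOfShape WalkingParallelPair (tensorLeft X) := hX
  have : PreservesLimitsOfShape WalkingParallelPair (tensorLeft Y) := hY
  preservesLimitsOfShape_of_natIso (tensorLeftTensor X Y).symm

variable [BraidedCategory C]

lemma Flat.preserves_tensorRight {H : C} (hH : Flat H) :
    PreservesLimitsOfShape WalkingParallelPair (tensorRight H) :=
  have : PreservesLimitsOfShape WalkingParallelPair (tensorLeft H) := hH
  preservesLimitsOfShape_of_natIso (BraidedCategory.tensorLeftIsoTensorRight H)

/-- The equalizer of two morphisms with respect to an object `A` that has a dual remains an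
equalizer after tensoring with a flat object. -/
lemma Flat.whiskerRight_equalizes {H D A M T : C} (hH : Flat H) [ExactPairing D A]
    (l r : A ⊗ M ⟶ M) (j : T ⟶ M) [Mono j] (hj : A ◁ j ≫ l = A ◁ j ≫ r)
    (hT : ∀ {X : C} (f : X ⟶ M), A ◁ f ≫ l = A ◁ f ≫ r → ∃ g, g ≫ j = f) :
    Mono (j ▷ H) ∧ ∀ {X : C} (f : X ⟶ M ⊗ H),
      A ◁ f ≫ (α_ A M H).inv ≫ l ▷ H = A ◁ f ≫ (α_ A M H).inv ≫ r ▷ H → ∃ g, g ≫ j ▷ H = f := by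
  -- The dual replaces [A, -] by D ⊗ -, which commutes with - ⊗ H by mere reassociation (`he'`).
  let e (X N : C) := tensorLeftHomEquiv X D A N
  have he {X Y N : C} (f : X ⟶ Y) (k : A ⊗ Y ⟶ N) : f ≫ e Y N k = e X N (A ◁ f ≫ k) := by
    change f ≫ (λ_ _).inv ≫ η_ D A ▷ Y ≫ (α_ _ _ _).hom ≫ D ◁ k =
      (λ_ _).inv ≫ η_ D A ▷ X ≫ (α_ _ _ _).hom ≫ D ◁ (A ◁ f ≫ k)
    rw [leftUnitor_inv_naturality_assoc, whisker_exchange_assoc]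
    monoidal
  have he' (k : A ⊗ M ⟶ M) : e M M k ▷ H ≫ (α_ D M H).hom =
      e (M ⊗ H) (M ⊗ H) ((α_ A M H).inv ≫ k ▷ H) := by
    change ((λ_ _).inv ≫ η_ D A ▷ M ≫ (α_ _ _ _).hom ≫ D ◁ k) ▷ H ≫ (α_ D M H).hom =
      (λ_ _).inv ≫ η_ D A ▷ (M ⊗ H) ≫ (α_ _ _ _).hom ≫ D ◁ ((α_ A M H).inv ≫ k ▷ H)
    monoidal
  have hw : j ≫ e M M l = j ≫ e M M r := by rw [he, he, hj]
  have key (s : Fork (e M M l) (e M M r)) : ∃ g, g ≫ j = s.ι :=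
    hT s.ι ((e _ _).injective (by rw [← he, ← he, s.condition]))
  choose g hg using key
  have hlim : IsLimit (Fork.ofι j hw) :=
    Fork.IsLimit.mk _ g hg fun s m hm => by
      rw [← cancel_mono j, hg]
      exact hm
  have := hH.preserves_tensorRight
  -- Flatness of H enters here: the fork exhibiting T as an equalizer stays one after tensoring with
  -- H.
  have hlim' := isLimitForkMapOfIsLimit (tensorRight H) hw hlim
  refine ⟨Fork.IsLimit.mono hlim', fun f hf => ?_⟩
  obtain ⟨g, hg⟩ := Fork.IsLimit.lift' hlim' f (by
    change f ≫ e M M l ▷ H = f ≫ e M M r ▷ H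
    rw [← cancel_mono (α_ D M H).hom, Category.assoc, Category.assoc, he', he', he, he, hf])
  exact ⟨g, hg⟩

/-- If `f` commutes with `i`, and the braidings of `A` and `H` are inverse to each other, then a
morphism of algebras `ρ : B ⟶ B ⊗ H` with `ρ(i(a)) = i(a) ⊗ 1` maps `f` to a morphism that commutes
with `a ↦ i(a) ⊗ 1`. -/
lemma Centralizes.coact {A B H X : C} [MonObj B] [MonObj H] {i : A ⟶ B}
    (hβ : (β_ A H).hom ≫ (β_ H A).hom = 𝟙 _) {f : X ⟶ B} (hf : Centralizes i f)
    (ρ : B ⟶ B ⊗ H) [IsMonHom ρ] (hi : i ≫ ρ = i ≫ twistInl B H) :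
    A ◁ (f ≫ ρ) ≫ (α_ A B H).inv ≫ (i ▷ B ≫ μ[B]) ▷ H =
      A ◁ (f ≫ ρ) ≫ (α_ A B H).inv ≫ ((β_ A B).hom ≫ B ◁ i ≫ μ[B]) ▷ H := by
  have h1 : A ◁ ρ ≫ (α_ A B H).inv ≫ (i ▷ B ≫ μ[B]) ▷ H = (i ▷ B ≫ μ[B]) ≫ ρ := by
    have e : (α_ A B H).inv ≫ (i ▷ B ≫ μ[B]) ▷ H = (i ≫ twistInl B H) ▷ (B ⊗ H) ≫ μ[B ⊗ H] := by
      rw [← twistMul_braiding, comp_whiskerRight i, Category.assoc, twistInl_mul]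
      monoidal
    rw [e, ← hi, Category.assoc, IsMonHom.mul_hom, MonoidalCategory.tensorHom_def',
      Category.assoc, comp_whiskerRight, Category.assoc, whisker_exchange_assoc]
  -- On the right, a crosses H twice: when it is moved behind B ⊗ H, and when it is multiplied in as
  -- i(a) ⊗ 1. The two crossings cancel by `hβ`.
  have h2 : A ◁ ρ ≫ (α_ A B H).inv ≫ ((β_ A B).hom ≫ B ◁ i ≫ μ[B]) ▷ H =
      ((β_ A B).hom ≫ B ◁ i ≫ μ[B]) ≫ ρ := by
    have e : (α_ A B H).inv ≫ ((β_ A B).hom ≫ B ◁ i ≫ μ[B]) ▷ H =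
        (β_ A (B ⊗ H)).hom ≫ (B ⊗ H) ◁ (i ≫ twistInl B H) ≫ μ[B ⊗ H] := by
      rw [← twistMul_braiding, MonoidalCategory.whiskerLeft_comp, Category.assoc, mul_twistInl,
        twistAct, BraidedCategory.braiding_tensor_right_hom]
      have e' : (B ⊗ H) ◁ i ≫ (α_ B H B).hom ≫ B ◁ (β_ H B).hom =
          (α_ B H A).hom ≫ B ◁ (β_ H A).hom ≫ B ◁ i ▷ H := by
        rw [← MonoidalCategory.whiskerLeft_comp, ← BraidedCategory.braiding_naturality_right]
        monoidal
      simp only [Category.assoc]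
      rw [reassoc_of% e', Iso.inv_hom_id_assoc, ← MonoidalCategory.whiskerLeft_comp_assoc B
        (β_ A H).hom, hβ]
      monoidal
    rw [e, ← hi, BraidedCategory.braiding_naturality_right_assoc]
    simp only [Category.assoc]
    rw [IsMonHom.mul_hom, MonoidalCategory.tensorHom_def, MonoidalCategory.whiskerLeft_comp,
      Category.assoc, Category.assoc, whisker_exchange_assoc]
  rw [MonoidalCategory.whiskerLeft_comp, Category.assoc, Category.assoc, h1, h2]
  rw [Centralizes] at hf
  simp only [Category.assoc] at hf ⊢
  rw [reassoc_of% hf]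

end Coaction

/-! ### Reflecting isomorphisms, and faithful flatness. -/

section Conservative

variable {C : Type u} [Category.{v} C] [MonoidalCategory C]

/-- A fork is an equalizer when its comparison with the equalizer is invertible, which can be tested
after a functor that preserves equalizers and reflects isomorphisms. -/
lemma Flat.faithfullyFlat [HasEqualizers C] {X : C} (hX : Flat X)
    [(tensorLeft X).ReflectsIsomorphisms] : FaithfullyFlat X :=
  have : PreservesLimitsOfShape WalkingParallelPair (tensorLeft X) := hX
  ⟨hX, reflectsLimitsOfShape_of_reflectsIsomorphisms⟩

/-- Tensoring with T and then A is the same as with H and then A. The composite inherits its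
properties from A and H, and A ⊗ - lets them be cancelled down to T. -/
lemma faithfullyFlat_of_tensor_iso [HasEqualizers C] {A T H : C} (e : A ⊗ T ≅ A ⊗ H) (hA : Flat A)
    [(tensorLeft A).ReflectsIsomorphisms] (hH : Flat H) [(tensorLeft H).ReflectsIsomorphisms] :
    FaithfullyFlat T := by
  let e' : tensorLeft H ⋙ tensorLeft A ≅ tensorLeft T ⋙ tensorLeft A :=
    (tensorLeftTensor A H).symm ≪≫ (curriedTensor C).mapIso e.symm ≪≫ tensorLeftTensor A T
  have : PreservesLimitsOfShape WalkingParallelPair (tensorLeft A) := hA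
  have : PreservesLimitsOfShape WalkingParallelPair (tensorLeft H) := hH
  have : ReflectsLimitsOfShape WalkingParallelPair (tensorLeft A) := hA.faithfullyFlat.2
  have : PreservesLimitsOfShape WalkingParallelPair (tensorLeft T ⋙ tensorLeft A) :=
    preservesLimitsOfShape_of_natIso e'
  have hT : Flat T := preservesLimitsOfShape_of_reflects_of_preserves _ (tensorLeft A)
  have : (tensorLeft T ⋙ tensorLeft A).ReflectsIsomorphisms := reflectsIsomorphisms_of_iso e'
  have : (tensorLeft T).ReflectsIsomorphisms := reflectsIsomorphisms_of_comp _ (tensorLeft A)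
  exact hT.faithfullyFlat

variable [BraidedCategory C]

lemma isIso_tensor_whiskerLeft (P Q : C) {X Y : C} (f : X ⟶ Y) [IsIso (P ◁ f)] :
    IsIso ((P ⊗ Q) ◁ f) := by
  have e : (P ⊗ Q) ◁ f = (β_ P Q).hom ▷ X ≫ (α_ Q P X).hom ≫ Q ◁ P ◁ f ≫ (α_ Q P Y).inv ≫
      (β_ P Q).inv ▷ Y := by
    have : (α_ Q P X).hom ≫ Q ◁ P ◁ f ≫ (α_ Q P Y).inv = (Q ⊗ P) ◁ f := by monoidal
    rw [reassoc_of% this, ← whisker_exchange_assoc, ← comp_whiskerRight]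
    simp
  rw [e]
  infer_instance

/-- Tensoring with a faithfully projective object reflects isomorphisms. -/
lemma IsFaithfullyProjective.isIso_of_whiskerLeft [MonoidalClosed C] {P : C}
    (hP : IsFaithfullyProjective P) {X Y : C} (f : X ⟶ Y) [IsIso (P ◁ f)] : IsIso f := by
  obtain ⟨hc⟩ := hP.coequalizer
  -- In a closed braided category - ⊗ Z preserves colimits, so P ⊗ P* ⊗ Z ⟶ I ⊗ Z is again a
  -- coequalizer.
  have hcolim (Z : C) := isColimitCoforkMapOfIsColimit (tensorRight Z) (evDual_condition P) hc
  have hepi (Z : C) : Epi (evDual P ▷ Z) := Cofork.IsColimit.epi (hcolim Z)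
  have := isIso_tensor_whiskerLeft P (dual P) f
  have := isIso_tensor_whiskerLeft P ((ihom P).obj P) f
  have := isIso_tensor_whiskerLeft (P ⊗ (ihom P).obj P) (dual P) f
  -- The inverse of P ⊗ P* ⊗ f descends along the coequalizer to an inverse of I ⊗ f.
  obtain ⟨g, hg⟩ := Cofork.IsColimit.desc' (hcolim Y) (inv ((P ⊗ dual P) ◁ f) ≫ evDual P ▷ X) (by
    change (evEnd P ▷ dual P) ▷ Y ≫ _ =
      ((α_ P ((ihom P).obj P) (dual P)).hom ≫ P ◁ endActDual P) ▷ Y ≫ _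
    rw [← cancel_epi (((P ⊗ (ihom P).obj P) ⊗ dual P) ◁ f), whisker_exchange_assoc,
      whisker_exchange_assoc, IsIso.hom_inv_id_assoc,
      ← comp_whiskerRight, ← comp_whiskerRight, evDual_condition])
  replace hg : evDual P ▷ Y ≫ g = inv ((P ⊗ dual P) ◁ f) ≫ evDual P ▷ X := hg
  have h : IsIso (𝟙_ C ◁ f) := by
    refine ⟨g, ?_, ?_⟩
    · rw [← cancel_epi (evDual P ▷ X), ← whisker_exchange_assoc, hg]
      simp
    · rw [← cancel_epi (evDual P ▷ Y), reassoc_of% hg, ← whisker_exchange]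
      simp
  have e : f = (λ_ X).inv ≫ 𝟙_ C ◁ f ≫ (λ_ Y).hom := by simp
  rw [e]
  infer_instance

/-- The unit and the counit make I a retract of H, so f is a retract of H ⊗ f. -/
lemma reflectsIsomorphisms_tensorLeft_of_bimon (H : C) [BimonObj H] :
    (tensorLeft H).ReflectsIsomorphisms where
  reflects {X Y} f hf := by
    have : IsIso (H ◁ f) := hf
    have h : η[H] ≫ ε[H] = 𝟙 (𝟙_ C) := BimonObj.one_counit H
    have h1 : η[H] ▷ X ≫ H ◁ f = 𝟙_ C ◁ f ≫ η[H] ▷ Y := (whisker_exchange _ _).symm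
    have h2 : ε[H] ▷ X ≫ 𝟙_ C ◁ f = H ◁ f ≫ ε[H] ▷ Y := (whisker_exchange _ _).symm
    have : IsIso (𝟙_ C ◁ f) := by
      refine ⟨η[H] ▷ Y ≫ inv (H ◁ f) ≫ ε[H] ▷ X, ?_, ?_⟩
      · rw [← reassoc_of% h1, IsIso.hom_inv_id_assoc, ← comp_whiskerRight, h, id_whiskerRight]
      · simp only [Category.assoc]
        rw [h2, IsIso.inv_hom_id_assoc, ← comp_whiskerRight, h, id_whiskerRight]
    have e : f = (λ_ X).inv ≫ 𝟙_ C ◁ f ≫ (λ_ Y).hom := by simp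
    rw [e]
    infer_instance

end Conservative

/-! ### From the category of H-modules to C. -/

section Descent

variable {C : Type u} [Category.{v} C] [MonoidalCategory C] {H : C}

lemma isIso_hom [MonObj H] {M N : Mod C H} (f : M ⟶ N) [IsIso f] : IsIso f.hom :=
  ⟨(inv f).hom, congrArg Mod.Hom.hom (IsIso.hom_inv_id f),
    congrArg Mod.Hom.hom (IsIso.inv_hom_id f)⟩

lemma isIso_of_isIso_hom [MonObj H] {M N : Mod C H} (f : M ⟶ N) [IsIso f.hom] :
    IsIso f := by
  have e : f = (isoMk (asIso f.hom) (act_hom f)).hom := rfl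
  rw [e]
  infer_instance

variable [BraidedCategory C] [MonoidalClosed C] [HopfObj H] [BraidingLinear H]

/-- Currying of modules is currying in C on underlying morphisms. So the forgetful functor sends
evaluations and the canonical morphisms below to those of C. -/
lemma curry_eq_ihomModEquiv {M X N : Mod C H} (f : M ⊗ X ⟶ N) :
    MonoidalClosed.curry f = ihomModEquiv M X N f := by
  have he (X' X N : Mod C H) (f : X' ⟶ X) (g : M ⊗ X ⟶ N) :
      ihomModEquiv M X' N ((tensorLeft M).map f ≫ g) = f ≫ ihomModEquiv M X N g :=
    Mod.hom_ext _ _ (MonoidalClosed.curry_natural_left f.hom g.hom)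
  exact congrFun (congrArg DFunLike.coe (congrFun (congrFun (Adjunction.mkOfHomEquiv_homEquiv
    (F := tensorLeft M)
    (G := Adjunction.rightAdjointOfEquiv (F := tensorLeft M) (ihomModEquiv M) he) _) X) N)) f

lemma ihom_ev_hom (M N : Mod C H) :
    ((ihom.ev M).app N).hom = (ihom.ev M.X).app N.X := by
  have h : MonoidalClosed.curry ((ihom.ev M).app N) = 𝟙 ((ihom M).obj N) := by
    rw [← MonoidalClosed.uncurry_id_eq_ev, MonoidalClosed.curry_uncurry]
  rw [curry_eq_ihomModEquiv] at h
  have h' : MonoidalClosed.curry ((ihom.ev M).app N).hom = 𝟙 ((ihom M.X).obj N.X) :=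
    congrArg Mod.Hom.hom h
  exact (MonoidalClosed.uncurry_curry _).symm.trans
    ((congrArg MonoidalClosed.uncurry h').trans (MonoidalClosed.uncurry_id_eq_ev _ _))

lemma dualToEnd_hom (A : Mod C H) : (dualToEnd A).hom = dualToEnd A.X := by
  rw [dualToEnd, curry_eq_ihomModEquiv]
  change MonoidalClosed.curry ((α_ _ _ _).inv ≫ (evDual A).hom ▷ _ ≫ (λ_ _).hom) = _
  rw [evDual, ihom_ev_hom]
  rfl

lemma leftEnvToEnd_hom (A : Mod C H) [MonObj A] : (leftEnvToEnd A).hom = leftEnvToEnd A.X := by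
  rw [leftEnvToEnd, curry_eq_ihomModEquiv]
  rfl

lemma isFinite_of_mod {A : Mod C H} (hA : IsFinite A) : IsFinite A.X := by
  have : IsIso (dualToEnd A) := hA
  have := isIso_hom (dualToEnd A)
  rwa [dualToEnd_hom] at this

lemma isIso_leftEnvToEnd_of_mod {A : Mod C H} [MonObj A] (hA : IsIso (leftEnvToEnd A)) :
    IsIso (leftEnvToEnd A.X) := by
  have := isIso_hom (leftEnvToEnd A)
  rwa [leftEnvToEnd_hom] at this

/-- Tensoring with the underlying object of a faithfully projective `H`-module reflects
isomorphisms. -/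
lemma reflectsIsomorphisms_of_mod {A : Mod C H} (hA : IsFaithfullyProjective A) :
    (tensorLeft A.X).ReflectsIsomorphisms where
  reflects {X Y} f hf := by
    have : IsIso (A.X ◁ f) := hf
    -- Every morphism of C is linear for trivial actions, so faithful projectivity among modules can
    -- be applied to f.
    let F : trivMod H X ⟶ trivMod H Y := homMk f (by
      change (ε[H] ▷ X ≫ (λ_ X).hom) ≫ f = H ◁ f ≫ ε[H] ▷ Y ≫ (λ_ Y).hom
      rw [whisker_exchange_assoc]
      simp)
    have : IsIso (A ◁ F).hom := this
    have := isIso_of_isIso_hom (A ◁ F)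
    have := hA.isIso_of_whiskerLeft F
    exact isIso_hom F

end Descent

/-! ### Comodule axioms on a subobject. -/

section Comodule

variable {C : Type u} [Category.{v} C] [MonoidalCategory C]

/-- A coaction on a subobject inherits the comodule axioms. -/
lemma IsRightComodule.of_mono {H : C} [ComonObj H] {B T : C} {ρ : B ⟶ B ⊗ H}
    (hρ : IsRightComodule H ρ) (j : T ⟶ B) [Mono j] [Mono (j ▷ (H ⊗ H))] (ρ' : T ⟶ T ⊗ H)
    (hj : ρ' ≫ j ▷ H = j ≫ ρ) : IsRightComodule H ρ' where
  counit := by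
    have : Mono (j ▷ 𝟙_ C) := by
      have e : j ▷ 𝟙_ C = (ρ_ T).hom ≫ j ≫ (ρ_ B).inv := by simp
      rw [e]
      infer_instance
    rw [← cancel_mono (j ▷ 𝟙_ C), Category.assoc, whisker_exchange, reassoc_of% hj, hρ.counit,
      rightUnitor_inv_naturality]
  coassoc := by
    rw [← cancel_mono (j ▷ (H ⊗ H))]
    simp only [Category.assoc]
    rw [whisker_exchange, reassoc_of% hj, hρ.coassoc, ← associator_naturality_left,
      ← comp_whiskerRight_assoc, hj, comp_whiskerRight_assoc, reassoc_of% hj]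

end Comodule

/-! ### The centralizer as a Galois object. -/

section Main

variable {C : Type u} [Category.{v} C] [MonoidalCategory C] [BraidedCategory C] [MonoidalClosed C]

/-- By duality P ⊗ - is right adjoint to P* ⊗ -. -/
lemma IsFinite.flat {P : C} (hP : IsFinite P) : Flat P :=
  let := hP.exactPairing'
  (tensorLeftAdjunction P (dual P)).rightAdjoint_preservesLimits.preservesLimitsOfShape

variable [HasEqualizers C]

/-- Let `B ≅ A ⊗ H` be a factorization of a comodule algebra `B` such that `A` is coinvariant and
an Azumaya algebra. Then the centralizer of `A` in `B` is an `H`-Galois object. -/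
theorem exists_isGaloisObject_centralizer {A B H : C} [HopfObj H] [MonObj A] [MonObj B]
    (hH : Flat H) (hβ : (β_ A H).hom ≫ (β_ H A).hom = 𝟙 _) (hA : IsFinite A)
    (hA' : IsIso (leftEnvToEnd A)) [(tensorLeft A).ReflectsIsomorphisms]
    (i : A ⟶ B) (q : H ⟶ B) [IsMonHom i] [IsMonHom q] [IsIso ((i ⊗ₘ q) ≫ μ[B])]
    (ρ : B ⟶ B ⊗ H) [IsMonHom ρ] (hρ : IsRightComodule H ρ) (hi : i ≫ ρ = i ≫ twistInl B H)
    (hq : ((i ⊗ₘ q) ≫ μ[B]) ≫ ρ = A ◁ Δ[H] ≫ (α_ A H H).inv ≫ ((i ⊗ₘ q) ≫ μ[B]) ▷ H) :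
    letI := centralizerMonObj i
    ∃ ρ' : centralizer i ⟶ centralizer i ⊗ H,
      ρ' ≫ centralizerι i ▷ H = centralizerι i ≫ ρ ∧ IsGaloisObject H (centralizer i) ρ' := by
  let := centralizerMonObj i
  let := hA.exactPairing
  have := isMonHom_centralizerι i
  have hm := isIso_mul_centralizerι i hA hA'
  have hT {X : C} (f : X ⟶ B) (hf : Centralizes i f) : ∃ g, g ≫ centralizerι i = f :=
    ⟨invariantsLift f hf, invariantsLift_ι _ _ _ _⟩
  obtain ⟨_, h1⟩ := hH.whiskerRight_equalizes (D := dual A) _ _ _ (centralizes_ι i) hT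
  -- Coassociativity on T is checked in B ⊗ H ⊗ H, so the embedding must stay monic there.
  have h2 := ((hH.tensor hH).whiskerRight_equalizes (D := dual A) _ _ _ (centralizes_ι i) hT).1
  obtain ⟨ρ', hρ'⟩ := h1 _ ((centralizes_ι i).coact hβ ρ hi)
  refine ⟨ρ', hρ', ⟨hρ.of_mono (centralizerι i) ρ' hρ', ?_⟩, ?_, ?_⟩
  · constructor
    · rw [← cancel_mono (centralizerι i ▷ H), Category.assoc, hρ', IsMonHom.one_hom_assoc,
        IsMonHom.one_hom, IsMonHom.one_hom]
    · rw [← cancel_mono (centralizerι i ▷ H), Category.assoc, hρ', IsMonHom.mul_hom_assoc,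
        IsMonHom.mul_hom, Category.assoc, IsMonHom.mul_hom, tensorHom_comp_tensorHom_assoc,
        tensorHom_comp_tensorHom_assoc, hρ']
  · have := reflectsIsomorphisms_tensorLeft_of_bimon H
    exact faithfullyFlat_of_tensor_iso
      (asIso (A ◁ centralizerι i ≫ i ▷ B ≫ μ[B]) ≪≫ (asIso ((i ⊗ₘ q) ≫ μ[B])).symm) hA.flat hH
  · have : IsIso ((tensorLeft A).map (can H (centralizer i) ρ')) :=
      isIso_whiskerLeft_can i q ρ hq (centralizerι i) ρ' hρ'
    exact isIso_of_reflects_iso _ (tensorLeft A)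

end Main

/-! ### The smash product meets the hypotheses on B. -/

section Smash

variable {C : Type u} [Category.{v} C] [MonoidalCategory C] [BraidedCategory C] {H : C}
  [BimonObj H] (A : Mod C H)

lemma isRightComodule_smashCoact : IsRightComodule H (smashCoact A) where
  counit := by
    have e : smashCoact A ≫ smash A ◁ ε[H] = A.X ◁ (Δ[H] ≫ H ◁ ε[H]) ≫ (α_ _ _ _).inv := by
      rw [smashCoact]; monoidal
    rw [e, ComonObj.comul_counit]
    monoidal
  coassoc := by
    have e : smashCoact A ≫ smash A ◁ Δ[H] = A.X ◁ (Δ[H] ≫ H ◁ Δ[H]) ≫ (α_ _ _ _).inv := by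
      rw [smashCoact]; monoidal
    rw [e, ComonObj.comul_assoc, smashCoact]
    monoidal

lemma inl_smashCoact :
    twistInl A.X H ≫ smashCoact A = twistInl A.X H ≫ (ρ_ (A.X ⊗ H)).inv ≫ (A.X ⊗ H) ◁ η[H] := by
  have h : η[H] ≫ Δ[H] = (λ_ (𝟙_ C)).inv ≫ η[H] ▷ 𝟙_ C ≫ H ◁ η[H] := by
    rw [BimonObj.one_comul, ← MonoidalCategory.tensorHom_def]; rfl
  have e : twistInl A.X H ≫ smashCoact A = (ρ_ A.X).inv ≫ A.X ◁ (η[H] ≫ Δ[H]) ≫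
      (α_ A.X H H).inv := by
    rw [twistInl, smashCoact]; monoidal
  rw [e, h, twistInl]
  monoidal

end Smash

end BraidedHopf

end

theorem mainTheorem3 {C : Type u} [Category.{v} C] [MonoidalCategory C] [BraidedCategory C]
    [MonoidalClosed C] [HasEqualizers C] [HasCoequalizers C]
    (H : C) [HopfObj H] [BraidingLinear H] (hH : Flat H)
    (A : CategoryTheory.Mod C H) [MonObj A] (hA : IsAzumayaAlgebra A) :
    ∃ (_ : MonObj (smashInvariants A)) (ρ : smashInvariants A ⟶ smashInvariants A ⊗ H),
      μ[smashInvariants A] ≫ smashInvariantsι A =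
        (smashInvariantsι A ⊗ₘ smashInvariantsι A) ≫ smashMul A ∧
      η[smashInvariants A] ≫ smashInvariantsι A = smashOne A ∧
      ρ ≫ smashInvariantsι A ▷ H = smashInvariantsι A ≫ smashCoact A ∧
      IsGaloisObject H (smashInvariants A) ρ := by
  let : MonObj (A.X ⊗ H) := twistMonObj (entwine H A.X)
  have := isMonHom_twistInl (entwine H A.X)
  have := isMonHom_twistInr (entwine H A.X)
  have := isMonHom_smashCoact A
  have := reflectsIsomorphisms_of_mod hA.faithfullyProjective
  have hinl : (twistInl A.X H ⊗ₘ twistInr A.X H) ≫ μ[A.X ⊗ H] = 𝟙 _ :=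
    twistInl_twistInr (entwine H A.X)
  have : IsIso ((twistInl A.X H ⊗ₘ twistInr A.X H) ≫ μ[A.X ⊗ H]) := by
    rw [hinl]; infer_instance
  have hβ : (β_ A.X H).hom ≫ (β_ H A.X).hom = 𝟙 _ := by
    rw [← cancel_epi (β_ H A.X).hom, reassoc_of% braiding_braiding_eq_id (H := H) A.X,
      Category.comp_id]
  obtain ⟨ρ, hρ, hG⟩ := exists_isGaloisObject_centralizer hH hβ
    (isFinite_of_mod hA.faithfullyProjective.finite) (isIso_leftEnvToEnd_of_mod hA.isIso_left)
    (twistInl A.X H) (twistInr A.X H) (smashCoact A) (isRightComodule_smashCoact A)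
    (inl_smashCoact A) (by rw [hinl]; simp [smashCoact])
  have hι := isMonHom_centralizerι (twistInl A.X H)
  -- By unfolding, the invariants of A # H are the centralizer of `twistInl`, and `smashMul` is
  -- `twistMul` of the entwining.
  exact ⟨centralizerMonObj (twistInl A.X H), ρ, hι.mul_hom, hι.one_hom, hρ, hG⟩
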